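/- Let $n\in\mathbb N$, $P=[-1,1]^n\subset\mathbb R^n$, and call a function on $\mathbb R^n$ periodic if it is $2$-periodic in each coordinate. Let $\mathcal S$ be the set of smooth periodic $f:\mathbb R^n\to\mathbb R$ such that $f(x)+\frac12\sum_i x_i^2$ is strictly convex, in the sense that its Hessian is positive definite everywhere. Let $\mathcal E$ be the $L^2(P)$-completion of $\mathcal S$: the limits in $L^2(P)$ of sequences in $\mathcal S$, each represented by its periodic representative $f:\mathbb R^n\to\mathbb R$ for which $u(x)=f(x)+\frac12\sum_i x_i^2$ is convex. For such $u$ the Hessian $D^2u$ exists almost everywhere in the sense of Alexandrov (second-order Taylor expansion), and $\int_P\log\det D^2u\,dx\in[-\infty,\infty)$, with $\log 0=-\infty$. Let $\eta:\mathbb R^n\to[0,\infty)$ be smooth, supported in the closed unit ball, with $\int_{\mathbb R^n}\eta=1$, and for $h>0$ put $$f_h(x)=h^{-n}\int_{\mathbb R^n}f(y)\,\eta\Big(\frac{x-y}{h}\Big)\,dy .$$ For $f\in\mathcal E$ and $r:\mathbb N\to\mathbb N$ with $r(i)\ge i$ for all $i$, put, for $m\ge 1$, $$u_m(x)=\frac{m}{m+1}\,f_{1/r(m)}(x)+\frac12\sum_{i=1}^n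 x_i^2 .$$ **Lemma 5.1.** Let $f\in\mathcal E$ and $u(x)=f(x)+\frac12\sum_i x_i^2$. 1. For every $r:\mathbb N\to\mathbb N$ with $r(i)\ge i$ for all $i\in\mathbb N$, $\lim_{m\to\infty}\|u_m-u\|_{L^2(P)}=0$. 2. If $\int_P\log\det(D^2u)\,dx>-\infty$, then there exists $r:\mathbb N\to\mathbb N$ with $r(i)\ge i$ for all $i\in\mathbb N$ such that $$\lim_{m\to\infty}\int_P\log\det(D^2u_m)\,dx=\int_P\log\det(D^2u)\,dx .$$ -/

import Mathlib

open MeasureTheory Filter Topology Asymptotics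
open scoped ContDiff Matrix ENNReal

noncomputable section

namespace TorusPotential

/-- The fundamental cube `P = [-1, 1]^n`. -/
def P (n : ℕ) : Set (EuclideanSpace ℝ (Fin n)) :=
  {x | ∀ i, x i ∈ Set.Icc (-1 : ℝ) 1}

/-- `f` is periodic with period cube `[-1, 1]^n`, i.e. `2`-periodic in each coordinate. -/
def IsPeriodic {n : ℕ} (f : EuclideanSpace ℝ (Fin n) → ℝ) : Prop :=
  ∀ (i : Fin n) (x : EuclideanSpace ℝ (Fin n)), f (x + EuclideanSpace.single i 2) = f x

/-- The potential `u(x) = f(x) + (1/2) ∑ xᵢ²` attached to `f`. -/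
def potential {n : ℕ} (f : EuclideanSpace ℝ (Fin n) → ℝ) (x : EuclideanSpace ℝ (Fin n)) : ℝ :=
  f x + 1 / 2 * ∑ i, x i ^ 2

/-- The space `𝓢` of smooth periodic `f` whose potential `u` is smooth and strictly convex, in the
sense that its (classical) second derivative is positive definite at every point. -/
def smoothPotentials (n : ℕ) : Set (EuclideanSpace ℝ (Fin n) → ℝ) :=
  {f | ContDiff ℝ ∞ f ∧ IsPeriodic f ∧
    ∀ x v : EuclideanSpace ℝ (Fin n), v ≠ 0 →
      0 < iteratedFDeriv ℝ 2 (potential f) x ![v, v]}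

/-- The `L²(P)`-completion `𝓔` of `𝓢`, as a space of functions: the limits in `L²(P)` of sequences
in `𝓢`, each limit class being represented by its periodic representative on `ℝⁿ` for which
`u = f + (1/2)|x|²` is convex (convex functions on `ℝⁿ` are continuous, so this representative
is unique). -/
def completedPotentials (n : ℕ) : Set (EuclideanSpace ℝ (Fin n) → ℝ) :=
  {f | IsPeriodic f ∧ ConvexOn ℝ Set.univ (potential f) ∧
    ∃ g : ℕ → EuclideanSpace ℝ (Fin n) → ℝ, (∀ k, g k ∈ smoothPotentials n) ∧
      Tendsto (fun k => eLpNorm (fun x => g k x - f x) 2 (volume.restrict (P n))) atTop (𝓝 0)}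

/-- A smooth mollifying kernel: nonnegative, supported in the unit ball, of total integral `1`. -/
structure IsMollifier {n : ℕ} (η : EuclideanSpace ℝ (Fin n) → ℝ) : Prop where
  smooth : ContDiff ℝ ∞ η
  nonneg : ∀ x, 0 ≤ η x
  support_subset : Function.support η ⊆ Metric.closedBall 0 1
  integral_eq_one : ∫ x, η x = 1

/-- The mollification `f_h(x) = h⁻ⁿ ∫ f(y) η((x - y)/h) dy`. -/
def mollify {n : ℕ} (η f : EuclideanSpace ℝ (Fin n) → ℝ) (h : ℝ)
    (x : EuclideanSpace ℝ (Fin n)) : ℝ :=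
  (h ^ n)⁻¹ * ∫ y, f y * η (h⁻¹ • (x - y))

/-- The approximations `u_m = m/(m+1) · f_{1/r(m)} + (1/2) ∑ xᵢ²`. -/
def approximant {n : ℕ} (η f : EuclideanSpace ℝ (Fin n) → ℝ) (r : ℕ → ℕ) (m : ℕ) :
    EuclideanSpace ℝ (Fin n) → ℝ :=
  potential fun x => (m : ℝ) / ((m : ℝ) + 1) * mollify η f (1 / (r m : ℝ)) x

/-- `u` has second derivative `A` at `x` in the sense of Alexandrov: it has a second-order Taylor
expansion `u(y) = u(x) + p·(y-x) + (1/2) (y-x)ᵀ A (y-x) + o(|y-x|²)` with `A` symmetric. For a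
function that is `C²` near `x` this is the classical Hessian matrix. -/
def HasHessianAt {n : ℕ} (u : EuclideanSpace ℝ (Fin n) → ℝ)
    (A : Matrix (Fin n) (Fin n) ℝ) (x : EuclideanSpace ℝ (Fin n)) : Prop :=
  A.IsSymm ∧ ∃ p : EuclideanSpace ℝ (Fin n),
    (fun y => u y - u x - inner ℝ p (y - x)
        - 1 / 2 * ((y - x).ofLp ⬝ᵥ (A *ᵥ (y - x).ofLp)))
      =o[𝓝 x] fun y => ‖y - x‖ ^ 2

open Classical in
/-- The matrix `D²u(x)`, which for a convex `u` exists at almost every `x`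
(and is set to `0` at the remaining points). -/
def hessian {n : ℕ} (u : EuclideanSpace ℝ (Fin n) → ℝ) (x : EuclideanSpace ℝ (Fin n)) :
    Matrix (Fin n) (Fin n) ℝ :=
  if h : ∃ A, HasHessianAt u A x then h.choose else 0

/-- `log det D²u(x)` as an extended real number, equal to `-∞` where the determinant vanishes. -/
def logDetHessian {n : ℕ} (u : EuclideanSpace ℝ (Fin n) → ℝ)
    (x : EuclideanSpace ℝ (Fin n)) : EReal :=
  ENNReal.log (ENNReal.ofReal (hessian u x).det)

/-- `∫_P log det D²u dx` as an extended real number: integral of the positive part minus integral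
of the negative part. -/
def logDetIntegral {n : ℕ} (u : EuclideanSpace ℝ (Fin n) → ℝ) : EReal :=
  ((∫⁻ x in P n, (logDetHessian u x).toENNReal : ℝ≥0∞) : EReal)
    - ((∫⁻ x in P n, (-logDetHessian u x).toENNReal : ℝ≥0∞) : EReal)

end TorusPotential

end

/-!
The statement holds for every rate `r`, and the rate `r(m) = m` serves in the second part.

Write `u` for the potential of `f`, `θ = m / (m + 1)` and `f_h(x) = ∫ f(x - h z) dν(z)`, where `ν`
is the probability measure with density `η`. Everything about Hessians is read off from centred
second differences: if `u` has a second-order Taylor expansion at `x` with Hessian `A`, then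
`(u(x + t v) + u(x - t v) - 2 u(x)) / t² → vᵀ A v` (`HasHessianAt.tendsto_secondDiff`). For convex
`u` these quotients are nonnegative, so Fatou's lemma applies to them. It gives two inequalities
that replace the decomposition of the distributional Hessian into absolutely continuous and singular
parts:

* `∫_P vᵀ D²u v ≤ |v|² |P|`, because periodic terms drop out of the integral of a second difference
  (`integral_quadForm_hessian_le`);
* `vᵀ D²u_m(x) v ≥ θ ∫ vᵀ D²u(x - h z) v dν(z) + (1 - θ) |v|²`
  (`IsMollifier.le_quadForm_of_hasHessianAt`).

The tangent plane inequality `log det A ≤ log det C + tr (C⁻¹ A) - n` at `C = D²u_m(x)`, averaged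
over `ν`, turns the second one into `log det D²u_m(x) ≥ θ ∫ log det D²u(x - h z) dν(z)`
(`average_log_det_le`). Integrating over `P`, where averages of translates of a periodic function
have the same integral, gives the lower bound for the limit.

For the upper bound, `D²u_m → D²u` at every point where `u` has a Hessian
(`IsMollifier.tendsto_quadForm_hessian_mollify`), and the tangent plane inequality at `C = ε⁻¹ I`
makes `c_ε + ε tr D²u_m - log det D²u_m` nonnegative. Fatou's lemma and `∫_P tr D²u_m ≤ n |P|` bound
the limit superior of the integrals by `∫_P log det D²u + ε n |P|` for each `ε > 0`.

Alexandrov's theorem is not needed: where the Hessian fails to exist, `log det D²u = -∞` by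
convention (for `n ≥ 1`), so finiteness of the integral forces existence almost everywhere once the
set of such points is known to be measurable (`measurableSet_exists_hasHessianAt`).
-/

noncomputable section

namespace TorusPotential

variable {n : ℕ}

/-! ### Second differences and Hessians -/

/-- The quadratic form `v ↦ vᵀ A v` of a matrix, on Euclidean vectors. -/
def quadForm (A : Matrix (Fin n) (Fin n) ℝ) (v : EuclideanSpace ℝ (Fin n)) : ℝ :=
  v.ofLp ⬝ᵥ (A *ᵥ v.ofLp)

/-- The centred second difference of `u` at `x` with step `v`. -/
def secondDiff (u : EuclideanSpace ℝ (Fin n) → ℝ) (x v : EuclideanSpace ℝ (Fin n)) : ℝ :=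
  u (x + v) + u (x - v) - 2 * u x

lemma quadForm_smul (A : Matrix (Fin n) (Fin n) ℝ) (t : ℝ) (v : EuclideanSpace ℝ (Fin n)) :
    quadForm A (t • v) = t ^ 2 * quadForm A v := by
  simp only [quadForm, WithLp.ofLp_smul, Matrix.mulVec_smul, dotProduct_smul, smul_dotProduct,
    smul_eq_mul]
  ring

lemma quadForm_neg (A : Matrix (Fin n) (Fin n) ℝ) (v : EuclideanSpace ℝ (Fin n)) :
    quadForm A (-v) = quadForm A v := by
  simp [quadForm, Matrix.mulVec_neg]

lemma quadForm_eq_sum (A : Matrix (Fin n) (Fin n) ℝ) (v : EuclideanSpace ℝ (Fin n)) :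
    quadForm A v = ∑ i, ∑ j, v i * (A i j * v j) := by
  simp [quadForm, dotProduct, Matrix.mulVec, Finset.mul_sum]

lemma quadForm_single (A : Matrix (Fin n) (Fin n) ℝ) (i : Fin n) :
    quadForm A (EuclideanSpace.single i 1) = A i i := by
  simp [quadForm]

/-- Polarization: a symmetric matrix is recovered from its quadratic form. -/
lemma apply_eq_polarization {A : Matrix (Fin n) (Fin n) ℝ} (hA : A.IsSymm) (i j : Fin n) :
    A i j = (quadForm A (EuclideanSpace.single i 1 + EuclideanSpace.single j 1)
      - quadForm A (EuclideanSpace.single i 1) - quadForm A (EuclideanSpace.single j 1)) / 2 := by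
  have h : A j i = A i j := hA.apply i j
  simp [quadForm, Matrix.mulVec_add, h]
  ring

lemma eq_of_quadForm_eq {A B : Matrix (Fin n) (Fin n) ℝ} (hA : A.IsSymm) (hB : B.IsSymm)
    (h : ∀ v, quadForm A v = quadForm B v) : A = B := by
  ext i j
  rw [apply_eq_polarization hA, apply_eq_polarization hB]
  simp only [h]

lemma trace_eq_sum_quadForm (A : Matrix (Fin n) (Fin n) ℝ) :
    A.trace = ∑ i, quadForm A (EuclideanSpace.single i 1) := by
  simp [Matrix.trace, quadForm_single]

lemma secondDiff_eq_of_taylor (u : EuclideanSpace ℝ (Fin n) → ℝ)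
    (A : Matrix (Fin n) (Fin n) ℝ) (x p v : EuclideanSpace ℝ (Fin n)) :
    secondDiff u x v = quadForm A v
      + (u (x + v) - u x - inner ℝ p v - 1 / 2 * quadForm A v)
      + (u (x - v) - u x - inner ℝ p (-v) - 1 / 2 * quadForm A (-v)) := by
  rw [quadForm_neg, inner_neg_right, secondDiff]
  ring

/-- The Taylor remainder along a line through the base point. -/
lemma isLittleO_taylor_line {u : EuclideanSpace ℝ (Fin n) → ℝ}
    {A : Matrix (Fin n) (Fin n) ℝ} {x p : EuclideanSpace ℝ (Fin n)}
    (h : (fun y => u y - u x - inner ℝ p (y - x)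
        - 1 / 2 * ((y - x).ofLp ⬝ᵥ (A *ᵥ (y - x).ofLp))) =o[𝓝 x] fun y => ‖y - x‖ ^ 2)
    (v : EuclideanSpace ℝ (Fin n)) :
    (fun t : ℝ => u (x + t • v) - u x - inner ℝ p (t • v) - 1 / 2 * quadForm A (t • v))
      =o[𝓝 0] fun t => t ^ 2 := by
  have ht : Tendsto (fun t : ℝ => x + t • v) (𝓝 0) (𝓝 x) := by
    have : Continuous (fun t : ℝ => x + t • v) := by fun_prop
    simpa using this.tendsto 0
  have h1 := h.comp_tendsto ht
  have h2 : (fun t : ℝ => ‖x + t • v - x‖ ^ 2) =O[𝓝 0] fun t : ℝ => t ^ 2 := by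
    refine IsBigO.of_bound (‖v‖ ^ 2) (Eventually.of_forall fun t => ?_)
    simp [norm_smul, mul_pow, mul_comm]
  have h3 := h1.trans_isBigO h2
  refine h3.congr_left fun t => ?_
  simp [quadForm]

/-- The pure second derivatives of the Taylor polynomial are limits of second difference
quotients. Every comparison of Hessians below goes through this limit. -/
lemma HasHessianAt.tendsto_secondDiff {u : EuclideanSpace ℝ (Fin n) → ℝ}
    {A : Matrix (Fin n) (Fin n) ℝ} {x : EuclideanSpace ℝ (Fin n)} (h : HasHessianAt u A x)
    (v : EuclideanSpace ℝ (Fin n)) :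
    Tendsto (fun t : ℝ => secondDiff u x (t • v) / t ^ 2) (𝓝[≠] 0) (𝓝 (quadForm A v)) := by
  obtain ⟨-, p, hp⟩ := h
  have h1 := (isLittleO_taylor_line hp v).tendsto_div_nhds_zero
  have h2 := (isLittleO_taylor_line hp (-v)).tendsto_div_nhds_zero
  have h3 := ((h1.add h2).const_add (quadForm A v)).mono_left (nhdsWithin_le_nhds (s := {0}ᶜ))
  rw [add_zero, add_zero] at h3
  refine h3.congr' ?_
  filter_upwards [self_mem_nhdsWithin] with t ht
  have ht : t ^ 2 ≠ 0 := pow_ne_zero 2 ht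
  rw [secondDiff_eq_of_taylor u A x p, add_assoc, add_div, add_div, quadForm_smul A t v,
    mul_div_cancel_left₀ _ ht]
  simp only [smul_neg, ← sub_eq_add_neg, quadForm_neg, quadForm_smul]

lemma tendsto_firstDiff_of_taylor {u : EuclideanSpace ℝ (Fin n) → ℝ}
    {A : Matrix (Fin n) (Fin n) ℝ} {x p : EuclideanSpace ℝ (Fin n)}
    (h : (fun y => u y - u x - inner ℝ p (y - x)
        - 1 / 2 * ((y - x).ofLp ⬝ᵥ (A *ᵥ (y - x).ofLp))) =o[𝓝 x] fun y => ‖y - x‖ ^ 2)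
    (v : EuclideanSpace ℝ (Fin n)) :
    Tendsto (fun t : ℝ => (u (x + t • v) - u x) / t) (𝓝[≠] 0) (𝓝 (inner ℝ p v)) := by
  have h1 := (isLittleO_taylor_line h v).tendsto_div_nhds_zero
  have h0 : Tendsto (fun t : ℝ => t) (𝓝 0) (𝓝 0) := tendsto_id
  have h3 := (((h1.mul h0).const_add (inner ℝ p v)).add
    (h0.mul_const (1 / 2 * quadForm A v))).mono_left (nhdsWithin_le_nhds (s := {0}ᶜ))
  simp only [mul_zero, zero_mul, add_zero] at h3
  refine h3.congr' ?_
  filter_upwards [self_mem_nhdsWithin] with t ht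
  have ht : t ≠ 0 := ht
  rw [quadForm_smul, inner_smul_right]
  field_simp
  ring

lemma HasHessianAt.unique {u : EuclideanSpace ℝ (Fin n) → ℝ}
    {A B : Matrix (Fin n) (Fin n) ℝ} {x : EuclideanSpace ℝ (Fin n)}
    (hA : HasHessianAt u A x) (hB : HasHessianAt u B x) : A = B :=
  eq_of_quadForm_eq hA.1 hB.1 fun v =>
    tendsto_nhds_unique (hA.tendsto_secondDiff v) (hB.tendsto_secondDiff v)

lemma HasHessianAt.hessian_eq {u : EuclideanSpace ℝ (Fin n) → ℝ}
    {A : Matrix (Fin n) (Fin n) ℝ} {x : EuclideanSpace ℝ (Fin n)} (h : HasHessianAt u A x) :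
    hessian u x = A := by
  have h' : ∃ A, HasHessianAt u A x := ⟨A, h⟩
  rw [hessian, dif_pos h']
  exact h'.choose_spec.unique h

lemma hasHessianAt_hessian {u : EuclideanSpace ℝ (Fin n) → ℝ} {x : EuclideanSpace ℝ (Fin n)}
    (h : ∃ A, HasHessianAt u A x) : HasHessianAt u (hessian u x) x := by
  obtain ⟨A, hA⟩ := h
  rwa [hA.hessian_eq]

/-- Translating the argument and adding an affine function does not change the Hessian. -/
lemma HasHessianAt.comp_add {u w : EuclideanSpace ℝ (Fin n) → ℝ}
    {A : Matrix (Fin n) (Fin n) ℝ} {x a q : EuclideanSpace ℝ (Fin n)} {c : ℝ}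
    (hA : HasHessianAt u A (x + a)) (hw : ∀ y, w y = u (y + a) + inner ℝ q y + c) :
    HasHessianAt w A x := by
  obtain ⟨sA, p, hp⟩ := hA
  refine ⟨sA, p + q, ?_⟩
  have ht : Tendsto (fun y => y + a) (𝓝 x) (𝓝 (x + a)) :=
    (continuous_id.add continuous_const).tendsto x
  have := hp.comp_tendsto ht
  simp only [Function.comp_def, add_sub_add_right_eq_sub] at this
  refine this.congr_left fun y => ?_
  rw [hw, hw, inner_add_left, inner_sub_right q]
  ring

lemma HasHessianAt.quadForm_nonneg {u : EuclideanSpace ℝ (Fin n) → ℝ}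
    {A : Matrix (Fin n) (Fin n) ℝ} {x : EuclideanSpace ℝ (Fin n)}
    (hA : HasHessianAt u A x) (hu : ∀ v, 0 ≤ secondDiff u x v) (v : EuclideanSpace ℝ (Fin n)) :
    0 ≤ quadForm A v :=
  ge_of_tendsto' (hA.tendsto_secondDiff v) fun t => div_nonneg (hu _) (sq_nonneg t)

/-! ### The tangent plane inequality for `log det` -/

lemma posDef_of_quadForm_pos {A : Matrix (Fin n) (Fin n) ℝ} (hA : A.IsSymm)
    (h : ∀ v, v ≠ 0 → 0 < quadForm A v) : A.PosDef := by
  have hH : A.IsHermitian := (Matrix.conjTranspose_eq_transpose_of_trivial A).trans hA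
  refine Matrix.PosDef.of_dotProduct_mulVec_pos hH fun v hv => ?_
  have := h (WithLp.toLp 2 v) (by simpa using hv)
  simpa [quadForm] using this

lemma posSemidef_of_quadForm_nonneg {A : Matrix (Fin n) (Fin n) ℝ} (hA : A.IsSymm)
    (h : ∀ v, 0 ≤ quadForm A v) : A.PosSemidef := by
  have hH : A.IsHermitian := (Matrix.conjTranspose_eq_transpose_of_trivial A).trans hA
  refine Matrix.PosSemidef.of_dotProduct_mulVec_nonneg hH fun v => ?_
  simpa [quadForm] using h (WithLp.toLp 2 v)

/-- The inequality `∏ λᵢ ≤ exp (∑ (λᵢ - 1))` for the eigenvalues. -/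
lemma det_le_exp_trace_sub {M : Matrix (Fin n) (Fin n) ℝ} (hM : M.PosSemidef) :
    M.det ≤ Real.exp (M.trace - n) := by
  have h1 : M.det = ∏ i, hM.1.eigenvalues i := by
    simpa using hM.1.det_eq_prod_eigenvalues
  have h2 : M.trace = ∑ i, hM.1.eigenvalues i := by
    simpa using hM.1.trace_eq_sum_eigenvalues
  have h3 : M.trace - n = ∑ i, (hM.1.eigenvalues i - 1) := by
    simp [h2]
  rw [h1, h3, Real.exp_sum]
  refine Finset.prod_le_prod (fun i _ => hM.eigenvalues_nonneg i) fun i _ => ?_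
  linarith [Real.add_one_le_exp (hM.1.eigenvalues i - 1)]

/-- The tangent plane inequality for the concave function `log det` at a positive definite `C`:
`log det A ≤ log det C + tr (C⁻¹ A) - n`, with the linear functional `A ↦ tr (C⁻¹ A)` written as a
sum of values of the quadratic form of `A`. -/
lemma exists_log_det_le {C : Matrix (Fin n) (Fin n) ℝ} (hC : C.PosDef) :
    ∃ b : Fin n → EuclideanSpace ℝ (Fin n), ∑ i, quadForm C (b i) = n ∧
      ∀ A : Matrix (Fin n) (Fin n) ℝ, A.PosSemidef → 0 < A.det →
        Real.log A.det ≤ Real.log C.det + ∑ i, quadForm A (b i) - n := by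
  obtain ⟨B, hB⟩ : ∃ B : Matrix (Fin n) (Fin n) ℝ, C⁻¹ = Bᴴ * B := by
    open scoped MatrixOrder in
    exact CStarAlgebra.nonneg_iff_eq_star_mul_self.mp hC.inv.posSemidef.nonneg
  have hdet := hC.det_pos
  have hu : IsUnit C.det := hdet.ne'.isUnit
  have key : ∀ A : Matrix (Fin n) (Fin n) ℝ,
      ∑ i, quadForm A (WithLp.toLp 2 (B i)) = (B * A * Bᴴ).trace := by
    intro A
    simp only [Matrix.trace, Matrix.diag, quadForm]
    refine Finset.sum_congr rfl fun i _ => ?_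
    rw [Matrix.mul_assoc, Matrix.mul_apply]
    simp [dotProduct, Matrix.mulVec, Matrix.mul_apply]
  have htr : ∀ A : Matrix (Fin n) (Fin n) ℝ, (B * A * Bᴴ).trace = (C⁻¹ * A).trace := by
    intro A
    rw [hB, Matrix.mul_assoc, Matrix.trace_mul_comm, Matrix.mul_assoc, Matrix.trace_mul_comm]
  refine ⟨fun i => WithLp.toLp 2 (B i), ?_, fun A hA hdA => ?_⟩
  · rw [key, htr, Matrix.nonsing_inv_mul _ hu]
    simp
  · rw [key]
    have hpsd : (B * A * Bᴴ).PosSemidef := hA.mul_mul_conjTranspose_same B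
    have h1 := det_le_exp_trace_sub hpsd
    have h2 : (B * A * Bᴴ).det = A.det / C.det := by
      have h3 : B.det * B.det = C.det⁻¹ := by
        have := congrArg Matrix.det hB
        rw [Matrix.det_mul, Matrix.det_conjTranspose, Matrix.det_nonsing_inv,
          Ring.inverse_eq_inv'] at this
        simpa using this.symm
      rw [Matrix.det_mul, Matrix.det_mul, Matrix.det_conjTranspose, star_trivial,
        mul_right_comm, h3]
      field_simp
    rw [h2] at h1
    have h3 := Real.log_le_log (div_pos hdA hdet) h1
    rw [Real.log_exp, Real.log_div hdA.ne' hdet.ne'] at h3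
    linarith

/-- The case `C = ε⁻¹ I` of the tangent plane inequality. -/
lemma log_det_le_trace {A : Matrix (Fin n) (Fin n) ℝ} (hA : A.PosSemidef) (hdet : 0 < A.det)
    {ε : ℝ} (hε : 0 < ε) : Real.log A.det ≤ -(n * Real.log ε) + ε * A.trace - n := by
  have h1 := det_le_exp_trace_sub (hA.smul hε.le)
  rw [Matrix.det_smul, Matrix.trace_smul, Fintype.card_fin, smul_eq_mul] at h1
  have h3 := Real.log_le_log (by positivity) h1
  rw [Real.log_exp, Real.log_mul (by positivity) hdet.ne', Real.log_pow] at h3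
  linarith

/-! ### Integration of periodic functions over the cube -/

/-- The basis `2 e₁, …, 2 eₙ` of the lattice of periods. -/
def periodBasis (n : ℕ) : Module.Basis (Fin n) ℝ (EuclideanSpace ℝ (Fin n)) :=
  (EuclideanSpace.basisFun (Fin n) ℝ).toBasis.isUnitSMul
    (w := fun _ => (2 : ℝ)) fun _ => isUnit_iff_ne_zero.mpr two_ne_zero

lemma periodBasis_apply (i : Fin n) : periodBasis n i = EuclideanSpace.single i 2 := by
  ext j
  simp [periodBasis, Module.Basis.isUnitSMul_apply]

lemma periodBasis_repr (x : EuclideanSpace ℝ (Fin n)) (i : Fin n) :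
    (periodBasis n).repr x i = 2⁻¹ * x i := by
  simp [periodBasis, Module.Basis.repr_isUnitSMul, Units.smul_def]

/-- The lattice of periods. -/
abbrev periodLattice (n : ℕ) : Submodule ℤ (EuclideanSpace ℝ (Fin n)) :=
  Submodule.span ℤ (Set.range (periodBasis n))

/-- Invariance under the generators gives invariance under the whole lattice of periods. -/
lemma apply_lattice_vadd {β : Type*} {F : EuclideanSpace ℝ (Fin n) → β}
    (hF : ∀ i x, F (x + EuclideanSpace.single i 2) = F x)
    (g : periodLattice n) (x : EuclideanSpace ℝ (Fin n)) : F (g +ᵥ x) = F x := by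
  obtain ⟨g, hg⟩ := g
  change F (g + x) = F x
  rw [add_comm]
  induction hg using Submodule.span_induction generalizing x with
  | mem y hy =>
    obtain ⟨i, rfl⟩ := hy
    rw [periodBasis_apply, hF]
  | zero => simp
  | add y z _ _ h1 h2 => rw [← add_assoc, h2, h1]
  | smul a y _ h =>
    induction a using Int.induction_on generalizing x with
    | zero => simp
    | succ a ih => rw [add_smul, one_smul, ← add_assoc, h, ih]
    | pred a ih => rw [← h, sub_smul, one_smul, add_assoc, sub_add_cancel, ih]

instance : VAddInvariantMeasure (periodLattice n) (EuclideanSpace ℝ (Fin n)) volume :=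
  ⟨fun g s _ => measure_preimage_add volume (g : EuclideanSpace ℝ (Fin n)) s⟩

instance : MeasurableConstVAdd (periodLattice n) (EuclideanSpace ℝ (Fin n)) :=
  ⟨fun g => measurable_const_add (g : EuclideanSpace ℝ (Fin n))⟩

lemma measurableSet_P (n : ℕ) : MeasurableSet (P n) := by
  rw [P, Set.ofPred_forall]
  refine MeasurableSet.iInter fun i => ?_
  exact measurableSet_Icc.preimage (by fun_prop)

lemma isCompact_P (n : ℕ) : IsCompact (P n) := by
  have h : P n = (EuclideanSpace.equiv (Fin n) ℝ).toHomeomorph ⁻¹'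
      (Set.univ.pi fun _ => Set.Icc (-1 : ℝ) 1) := by
    ext x
    simp only [P, Set.mem_ofPred_eq, Set.mem_preimage, Set.mem_pi, Set.mem_univ, true_imp_iff]
    rfl
  rw [h, Homeomorph.isCompact_preimage]
  exact isCompact_univ_pi fun _ => isCompact_Icc

lemma volume_P_ne_top (n : ℕ) : volume (P n) ≠ ⊤ := (isCompact_P n).measure_ne_top

/-- The half-open period cell with corner `a`. -/
def periodCell (a : EuclideanSpace ℝ (Fin n)) : Set (EuclideanSpace ℝ (Fin n)) :=
  (fun x => x - a) ⁻¹' ZSpan.fundamentalDomain (periodBasis n)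

lemma isAddFundamentalDomain_periodCell (a : EuclideanSpace ℝ (Fin n)) :
    IsAddFundamentalDomain (periodLattice n) (periodCell a) volume := by
  refine IsAddFundamentalDomain.mk' ?_ fun x => ?_
  · exact ((ZSpan.fundamentalDomain_measurableSet (periodBasis n)).preimage
      (by fun_prop)).nullMeasurableSet
  · have h := ZSpan.exist_unique_vadd_mem_fundamentalDomain (periodBasis n) (x - a)
    have e : ∀ g : periodLattice n,
        (g +ᵥ x ∈ periodCell a) = (g +ᵥ (x - a) ∈ ZSpan.fundamentalDomain (periodBasis n)) := by
      intro g
      have : g +ᵥ (x - a) = (g +ᵥ x) - a := by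
        change (g : EuclideanSpace ℝ (Fin n)) + (x - a) = g + x - a
        abel
      rw [this]
      rfl
    simpa only [e] using h

/-- The lower corner `(-1, …, -1)` of the cube `P`. -/
def corner (n : ℕ) : EuclideanSpace ℝ (Fin n) := WithLp.toLp 2 fun _ => -1

lemma P_ae_eq (n : ℕ) : P n =ᵐ[volume] periodCell (corner n) := by
  have h := (Measure.univ_pi_Ico_ae_eq_Icc (μ := fun _ : Fin n => (volume : Measure ℝ))
    (f := fun _ => (-1 : ℝ)) (g := fun _ => 1)).symm
  have hq := (EuclideanSpace.volume_preserving_symm_measurableEquiv_toLp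
    (Fin n)).quasiMeasurePreserving.preimage_ae_eq h
  refine (EventuallyEq.of_eq (Set.ext fun x => ?_)).trans
    (hq.trans (EventuallyEq.of_eq (Set.ext fun x => ?_)))
  · simp [P, Pi.le_def, forall_and]
  · simp only [periodCell, Set.mem_preimage, ZSpan.mem_fundamentalDomain, periodBasis_repr,
      Set.mem_pi, corner]
    simp
    refine forall_congr' fun i => ?_
    constructor <;> rintro ⟨h1, h2⟩ <;> constructor <;> linarith

section Periodic

variable {F : EuclideanSpace ℝ (Fin n) → ℝ}

lemma IsPeriodic.setIntegral_add (hF : IsPeriodic F) (a : EuclideanSpace ℝ (Fin n)) :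
    ∫ x in P n, F (x + a) = ∫ x in P n, F x := by
  have h1 := (measurePreserving_add_right volume a).setIntegral_preimage_emb
    (measurableEmbedding_addRight a) F (periodCell (corner n + a))
  have h2 : (fun x => x + a) ⁻¹' periodCell (corner n + a) = periodCell (corner n) := by
    ext x
    simp [periodCell]
  rw [h2] at h1
  rw [setIntegral_congr_set (P_ae_eq n), setIntegral_congr_set (P_ae_eq n), h1]
  exact (isAddFundamentalDomain_periodCell _).setIntegral_eq
    (isAddFundamentalDomain_periodCell _) (apply_lattice_vadd hF)

lemma IsPeriodic.integrableOn_add (hF : IsPeriodic F) (a : EuclideanSpace ℝ (Fin n))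
    (h : IntegrableOn F (P n)) : IntegrableOn (fun x => F (x + a)) (P n) := by
  have h1 := (measurePreserving_add_right volume a).integrableOn_comp_preimage
    (measurableEmbedding_addRight a) (f := F) (s := periodCell (corner n + a))
  have h2 : (fun x => x + a) ⁻¹' periodCell (corner n + a) = periodCell (corner n) := by
    ext x
    simp [periodCell]
  rw [h2] at h1
  rw [integrableOn_congr_set_ae (P_ae_eq n)] at h ⊢
  refine h1.mpr ?_
  rwa [(isAddFundamentalDomain_periodCell _).integrableOn_iff
    (isAddFundamentalDomain_periodCell (corner n)) (apply_lattice_vadd hF)]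

end Periodic

/-- A periodic property that holds almost everywhere on `P` holds almost everywhere. -/
lemma ae_of_ae_P {p : EuclideanSpace ℝ (Fin n) → Prop}
    (hp : ∀ i x, p (x + EuclideanSpace.single i 2) ↔ p x)
    (h : ∀ᵐ x ∂(volume.restrict (P n)), p x) : ∀ᵐ x, p x := by
  rw [Measure.restrict_congr_set (P_ae_eq n), ae_iff] at h
  refine (isAddFundamentalDomain_periodCell (corner n)).measure_zero_of_invariant {x | ¬ p x}
    (fun g => ?_) ?_
  · ext x
    have := apply_lattice_vadd (F := p) (fun i x => propext (hp i x)) (-g) x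
    rw [Set.mem_vadd_set_iff_neg_vadd_mem, Set.mem_ofPred_eq, this, Set.mem_ofPred_eq]
  · refine le_antisymm (h ▸ Measure.le_restrict_apply _ _) zero_le

/-! ### Measurability of the pointwise Hessian -/

/-- The step sizes `1 / (k + 1)` along which difference quotients are evaluated. -/
def step (k : ℕ) : ℝ := 1 / ((k : ℝ) + 1)

lemma step_pos (k : ℕ) : 0 < step k := Nat.one_div_pos_of_nat

lemma tendsto_step : Tendsto step atTop (𝓝[≠] 0) :=
  tendsto_nhdsWithin_iff.mpr ⟨tendsto_one_div_add_atTop_nhds_zero_nat,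
    Eventually.of_forall fun k => (step_pos k).ne'⟩

section Measurability

variable {u : EuclideanSpace ℝ (Fin n) → ℝ}

/-- The candidate for the directional derivative of `u` at `x` along `v`, meaningful only where the
limit exists. -/
def gradLim (u : EuclideanSpace ℝ (Fin n) → ℝ) (v x : EuclideanSpace ℝ (Fin n)) : ℝ :=
  limUnder atTop fun k => (u (x + step k • v) - u x) / step k

/-- The candidate for the pure second derivative of `u` at `x` along `v`, meaningful only where the
limit exists. -/
def quadLim (u : EuclideanSpace ℝ (Fin n) → ℝ) (v x : EuclideanSpace ℝ (Fin n)) : ℝ :=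
  limUnder atTop fun k => secondDiff u x (step k • v) / step k ^ 2

/-- The candidate for the Hessian matrix of `u` at `x`, obtained by polarization. -/
def matLim (u : EuclideanSpace ℝ (Fin n) → ℝ) (x : EuclideanSpace ℝ (Fin n)) :
    Matrix (Fin n) (Fin n) ℝ :=
  Matrix.of fun i j => (quadLim u (EuclideanSpace.single i 1 + EuclideanSpace.single j 1) x
    - quadLim u (EuclideanSpace.single i 1) x - quadLim u (EuclideanSpace.single j 1) x) / 2

lemma measurable_gradLim (hu : Continuous u) (v : EuclideanSpace ℝ (Fin n)) :
    Measurable (gradLim u v) := by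
  refine (StronglyMeasurable.limUnder fun k => ?_).measurable
  exact (by fun_prop : Continuous fun x => (u (x + step k • v) - u x) / step k).stronglyMeasurable

lemma measurable_matLim (hu : Continuous u) (i j : Fin n) :
    Measurable fun x => matLim u x i j := by
  have h : ∀ v, Measurable (quadLim u v) := fun v => by
    refine (StronglyMeasurable.limUnder fun k => ?_).measurable
    unfold secondDiff
    exact (by fun_prop : Continuous fun x =>
      (u (x + step k • v) + u (x - step k • v) - 2 * u x) / step k ^ 2).stronglyMeasurable
  exact (((h _).sub (h _)).sub (h _)).div_const 2

lemma matLim_isSymm (u : EuclideanSpace ℝ (Fin n) → ℝ) (x : EuclideanSpace ℝ (Fin n)) :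
    (matLim u x).IsSymm := by
  ext i j
  simp only [matLim, Matrix.transpose_apply, Matrix.of_apply]
  rw [add_comm (EuclideanSpace.single j 1)]
  ring

lemma HasHessianAt.matLim_eq {A : Matrix (Fin n) (Fin n) ℝ} {x : EuclideanSpace ℝ (Fin n)}
    (h : HasHessianAt u A x) : matLim u x = A := by
  have hq : ∀ v, quadLim u v x = quadForm A v := fun v =>
    ((h.tendsto_secondDiff v).comp tendsto_step).limUnder_eq
  ext i j
  rw [apply_eq_polarization h.1, matLim, Matrix.of_apply, hq, hq, hq]

/-- The remainder of the candidate second-order Taylor expansion. -/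
def taylorRemainder (u : EuclideanSpace ℝ (Fin n) → ℝ) (x v : EuclideanSpace ℝ (Fin n)) : ℝ :=
  u (x + v) - u x - ∑ i, v i * gradLim u (EuclideanSpace.single i 1) x
    - 1 / 2 * quadForm (matLim u x) v

lemma measurable_taylorRemainder (hu : Continuous u) (v : EuclideanSpace ℝ (Fin n)) :
    Measurable fun x => taylorRemainder u x v := by
  have h1 := measurable_matLim hu
  have h2 := measurable_gradLim hu
  have h3 : Measurable u := hu.measurable
  simp only [taylorRemainder, quadForm_eq_sum]
  fun_prop

/-- Existence of the Hessian in countably many conditions: the limits of difference quotients are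
the only possible coefficients, and by continuity the remainder need only be controlled on a
countable dense set of increments. -/
lemma exists_hasHessianAt_iff (hu : Continuous u) (x : EuclideanSpace ℝ (Fin n)) :
    (∃ A, HasHessianAt u A x) ↔ ∀ N : ℕ, ∃ M : ℕ, ∀ k : ℕ,
      ‖TopologicalSpace.denseSeq (EuclideanSpace ℝ (Fin n)) k‖ < step M →
        |taylorRemainder u x (TopologicalSpace.denseSeq _ k)|
          ≤ step N * ‖TopologicalSpace.denseSeq (EuclideanSpace ℝ (Fin n)) k‖ ^ 2 := by
  have hsum : ∀ p v : EuclideanSpace ℝ (Fin n), inner ℝ p v = ∑ i, v i * p i := by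
    intro p v
    simp [PiLp.inner_apply]
  constructor
  · rintro ⟨A, hA⟩ N
    have hm := hA.matLim_eq
    obtain ⟨-, p, hp⟩ := hA
    have hg : ∀ i, gradLim u (EuclideanSpace.single i 1) x = p i := fun i => by
      have : gradLim u (EuclideanSpace.single i 1) x = inner ℝ p (EuclideanSpace.single i 1) :=
        ((tendsto_firstDiff_of_taylor hp _).comp tendsto_step).limUnder_eq
      simpa [EuclideanSpace.inner_single_right] using this
    have h1 := hp.def (step_pos N)
    rw [Metric.eventually_nhds_iff] at h1
    obtain ⟨δ, hδ, h1⟩ := h1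
    obtain ⟨M, hM⟩ := exists_nat_one_div_lt hδ
    refine ⟨M, fun k hk => ?_⟩
    set v := TopologicalSpace.denseSeq (EuclideanSpace ℝ (Fin n)) k
    have h2 := h1 (y := x + v) (by simpa using hk.trans hM)
    simpa [taylorRemainder, hg, hm, hsum, quadForm] using h2
  · intro h
    refine ⟨matLim u x, matLim_isSymm u x,
      WithLp.toLp 2 fun i => gradLim u (EuclideanSpace.single i 1) x, ?_⟩
    refine IsLittleO.of_bound fun c hc => ?_
    obtain ⟨N, hN⟩ := exists_nat_one_div_lt hc
    obtain ⟨M, hM⟩ := h N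
    have hcl : ∀ v ∈ Metric.ball (0 : EuclideanSpace ℝ (Fin n)) (step M),
        |taylorRemainder u x v| ≤ step N * ‖v‖ ^ 2 := by
      have hcont : Continuous fun v => taylorRemainder u x v := by
        simp only [taylorRemainder, quadForm_eq_sum]
        fun_prop
      have hclosed : IsClosed {v | |taylorRemainder u x v| ≤ step N * ‖v‖ ^ 2} :=
        isClosed_le (by fun_prop) (by fun_prop)
      have hd := (TopologicalSpace.denseRange_denseSeq
        (EuclideanSpace ℝ (Fin n))).open_subset_closure_inter
          (Metric.isOpen_ball (x := (0 : EuclideanSpace ℝ (Fin n))) (ε := step M))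
      refine hd.trans (hclosed.closure_subset_iff.mpr ?_)
      rintro _ ⟨hv, k, rfl⟩
      exact hM k (by simpa using hv)
    filter_upwards [Metric.ball_mem_nhds x (step_pos M)] with y hy
    have h2 := hcl (y - x) (by simpa [dist_eq_norm] using hy)
    have h3 : step N * ‖y - x‖ ^ 2 ≤ c * ‖y - x‖ ^ 2 :=
      mul_le_mul_of_nonneg_right hN.le (sq_nonneg _)
    rw [hsum]
    simpa [taylorRemainder, quadForm] using h2.trans h3

lemma measurableSet_exists_hasHessianAt (hu : Continuous u) :
    MeasurableSet {x | ∃ A, HasHessianAt u A x} := by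
  simp only [exists_hasHessianAt_iff hu, Set.ofPred_forall, Set.ofPred_exists]
  refine MeasurableSet.iInter fun N => MeasurableSet.iUnion fun M =>
    MeasurableSet.iInter fun k => MeasurableSet.iInter fun _ => ?_
  exact measurableSet_le (measurable_taylorRemainder hu _).abs measurable_const

lemma measurable_hessian_apply (hu : Continuous u) (i j : Fin n) :
    Measurable fun x => hessian u x i j := by
  classical
  have h : (fun x => hessian u x i j) =
      {x | ∃ A, HasHessianAt u A x}.indicator fun x => matLim u x i j := by
    ext x
    by_cases hx : ∃ A, HasHessianAt u A x
    · rw [Set.indicator_of_mem (by exact hx), (hasHessianAt_hessian hx).matLim_eq]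
    · rw [Set.indicator_of_notMem (by exact hx), hessian, dif_neg hx, Matrix.zero_apply]
  rw [h]
  exact (measurable_matLim hu i j).indicator (measurableSet_exists_hasHessianAt hu)

lemma measurable_det_hessian (hu : Continuous u) : Measurable fun x => (hessian u x).det := by
  have h1 := measurable_hessian_apply hu
  simp only [Matrix.det_apply]
  fun_prop

end Measurability

/-! ### Fatou's lemma and the mean of the Hessian -/

/-- Fatou's lemma for nonnegative real functions whose integrals are infinitely often bounded
by `c`. -/
lemma integrable_and_integral_le_of_tendsto {α : Type*} [MeasurableSpace α] {μ : Measure α}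
    {F : ℕ → α → ℝ} {G : α → ℝ} {c : ℝ} (hF : ∀ k, Integrable (F k) μ)
    (hF0 : ∀ k, 0 ≤ᵐ[μ] F k) (hG : ∀ᵐ x ∂μ, Tendsto (fun k => F k x) atTop (𝓝 (G x)))
    (hc : ∃ᶠ k in atTop, ∫ x, F k x ∂μ ≤ c) : Integrable G μ ∧ ∫ x, G x ∂μ ≤ c := by
  have hmeas : AEStronglyMeasurable G μ :=
    aestronglyMeasurable_of_tendsto_ae atTop (fun k => (hF k).1) hG
  have hG0 : 0 ≤ᵐ[μ] G := by
    filter_upwards [hG, ae_all_iff.mpr hF0] with x hx h0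
    exact ge_of_tendsto' hx h0
  have hc0 : 0 ≤ c := by
    obtain ⟨k, hk⟩ := hc.exists
    exact (integral_nonneg_of_ae (hF0 k)).trans hk
  have hle : ∫⁻ x, ENNReal.ofReal (G x) ∂μ ≤ ENNReal.ofReal c := by
    calc ∫⁻ x, ENNReal.ofReal (G x) ∂μ
        = ∫⁻ x, liminf (fun k => ENNReal.ofReal (F k x)) atTop ∂μ := by
          refine lintegral_congr_ae ?_
          filter_upwards [hG] with x hx
          exact ((ENNReal.continuous_ofReal.tendsto _).comp hx).liminf_eq.symm
      _ ≤ liminf (fun k => ∫⁻ x, ENNReal.ofReal (F k x) ∂μ) atTop :=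
          lintegral_liminf_le' fun k => (hF k).1.aemeasurable.ennreal_ofReal
      _ ≤ ENNReal.ofReal c := by
          refine liminf_le_of_frequently_le' (hc.mono fun k hk => ?_)
          rw [← ofReal_integral_eq_lintegral_ofReal (hF k) (hF0 k)]
          exact ENNReal.ofReal_le_ofReal hk
  refine ⟨⟨hmeas, ?_⟩, ?_⟩
  · rw [hasFiniteIntegral_iff_ofReal hG0]
    exact hle.trans_lt ENNReal.ofReal_lt_top
  · rw [integral_eq_lintegral_of_nonneg_ae hG0 hmeas]
    exact ENNReal.toReal_le_of_le_ofReal hc0 hle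

lemma secondDiff_potential (f : EuclideanSpace ℝ (Fin n) → ℝ)
    (x v : EuclideanSpace ℝ (Fin n)) :
    secondDiff (potential f) x v = secondDiff f x v + ‖v‖ ^ 2 := by
  simp only [secondDiff, potential, EuclideanSpace.real_norm_sq_eq, PiLp.add_apply, PiLp.sub_apply,
    add_sq, sub_sq, Finset.sum_add_distrib, Finset.sum_sub_distrib]
  ring

lemma continuous_potential {f : EuclideanSpace ℝ (Fin n) → ℝ} (hf : Continuous f) :
    Continuous (potential f) := by
  unfold TorusPotential.potential
  fun_prop

/-- The periodic part of `u` does not contribute to the mean over `P` of second differences, so by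
Fatou the mean of `vᵀ D²u v` is at most `|v|²`. -/
lemma integral_quadForm_hessian_le {f : EuclideanSpace ℝ (Fin n) → ℝ} (hf : IsPeriodic f)
    (hc : Continuous f) (hconv : ∀ x v, 0 ≤ secondDiff (potential f) x v)
    (hD : ∀ᵐ x ∂(volume.restrict (P n)), ∃ A, HasHessianAt (potential f) A x)
    (v : EuclideanSpace ℝ (Fin n)) :
    IntegrableOn (fun x => quadForm (hessian (potential f) x) v) (P n) ∧
      ∫ x in P n, quadForm (hessian (potential f) x) v ≤ ‖v‖ ^ 2 * volume.real (P n) := by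
  have hint : ∀ g : EuclideanSpace ℝ (Fin n) → ℝ, Continuous g → IntegrableOn g (P n) :=
    fun g hg => hg.continuousOn.integrableOn_compact (isCompact_P n)
  refine integrable_and_integral_le_of_tendsto
    (F := fun k x => secondDiff (potential f) x (step k • v) / step k ^ 2)
    (fun k => ?_) (fun k => ?_) ?_ (Frequently.of_forall fun k => le_of_eq ?_)
  · refine hint _ ?_
    have := continuous_potential hc
    unfold secondDiff
    fun_prop
  · exact Eventually.of_forall fun x => div_nonneg (hconv _ _) (sq_nonneg _)
  · filter_upwards [hD] with x hx
    exact ((hasHessianAt_hessian hx).tendsto_secondDiff v).comp tendsto_step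
  · have h0 : ∫ x in P n, secondDiff f x (step k • v) = 0 := by
      simp only [secondDiff, sub_eq_add_neg]
      rw [integral_add, integral_add, integral_neg, integral_const_mul, hf.setIntegral_add,
        hf.setIntegral_add]
      · ring
      all_goals exact hint _ (by fun_prop)
    have h1 : ∀ x, secondDiff (potential f) x (step k • v) / step k ^ 2
        = secondDiff f x (step k • v) / step k ^ 2 + ‖v‖ ^ 2 := by
      intro x
      have := (step_pos k).ne'
      rw [secondDiff_potential, norm_smul, mul_pow, Real.norm_eq_abs, sq_abs]
      field_simp
    simp only [h1]
    rw [integral_add, integral_div, h0, zero_div, zero_add, integral_const]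
    · simp [mul_comm]
    · refine hint _ ?_
      unfold secondDiff
      fun_prop
    · exact hint _ continuous_const

/-- The Hessian of the potential of a periodic function is periodic. -/
lemma hasHessianAt_potential_add_iff {f : EuclideanSpace ℝ (Fin n) → ℝ} (hf : IsPeriodic f)
    (i : Fin n) (x : EuclideanSpace ℝ (Fin n)) (A : Matrix (Fin n) (Fin n) ℝ) :
    HasHessianAt (potential f) A (x + EuclideanSpace.single i 2) ↔
      HasHessianAt (potential f) A x := by
  set e : EuclideanSpace ℝ (Fin n) := EuclideanSpace.single i 2
  have key : ∀ y, potential f (y + e) = potential f y + inner ℝ e y + 2 := by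
    intro y
    have h2 := EuclideanSpace.real_norm_sq_eq (y + e)
    have h3 := EuclideanSpace.real_norm_sq_eq y
    have h4 : ‖e‖ ^ 2 = 4 := by
      simp [e]
      norm_num
    rw [norm_add_sq_real, real_inner_comm, h4] at h2
    rw [potential, potential, ← h2, ← h3, hf i y]
    ring
  constructor
  · intro h
    refine h.comp_add (q := -e) (c := -2) fun y => ?_
    rw [key, inner_neg_left]
    ring
  · intro h
    refine HasHessianAt.comp_add (u := potential f) (a := -e) (q := e) (c := 2 - ‖e‖ ^ 2)
      (by simpa using h) fun y => ?_
    have := key (y + -e)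
    rw [neg_add_cancel_right] at this
    rw [this, inner_add_right, inner_neg_right, real_inner_self_eq_norm_sq]
    ring

lemma hessian_potential_add {f : EuclideanSpace ℝ (Fin n) → ℝ} (hf : IsPeriodic f)
    (i : Fin n) (x : EuclideanSpace ℝ (Fin n)) :
    hessian (potential f) (x + EuclideanSpace.single i 2) = hessian (potential f) x := by
  by_cases hx : ∃ A, HasHessianAt (potential f) A x
  · exact ((hasHessianAt_potential_add_iff hf i x _).mpr (hasHessianAt_hessian hx)).hessian_eq
  · have hx' : ¬ ∃ A, HasHessianAt (potential f) A (x + EuclideanSpace.single i 2) := by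
      simpa only [hasHessianAt_potential_add_iff hf] using hx
    rw [hessian, hessian, dif_neg hx, dif_neg hx']

/-! ### Mollification and domination of Hessians -/

lemma quasiMeasurePreserving_sub_smul {h : ℝ} (hh : h ≠ 0) (x : EuclideanSpace ℝ (Fin n)) :
    Measure.QuasiMeasurePreserving (fun z => x - h • z)
      (volume : Measure (EuclideanSpace ℝ (Fin n))) volume := by
  have h1 : Measure.QuasiMeasurePreserving (fun z => h • z)
      (volume : Measure (EuclideanSpace ℝ (Fin n))) volume := by
    refine ⟨measurable_const_smul h, ?_⟩
    rw [Measure.map_addHaar_smul _ hh]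
    exact Measure.smul_absolutelyContinuous
  exact (quasiMeasurePreserving_sub_left volume x).comp h1

section Mollification

variable {η f : EuclideanSpace ℝ (Fin n) → ℝ}

/-- The probability measure with density `η`. -/
def kernelMeasure (η : EuclideanSpace ℝ (Fin n) → ℝ) : Measure (EuclideanSpace ℝ (Fin n)) :=
  volume.withDensity fun z => ENNReal.ofReal (η z)

lemma IsMollifier.hasCompactSupport (hη : IsMollifier η) : HasCompactSupport η :=
  HasCompactSupport.intro (isCompact_closedBall 0 1) fun x hx => by
    by_contra h
    exact hx (hη.support_subset h)

lemma IsMollifier.isProbabilityMeasure (hη : IsMollifier η) :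
    IsProbabilityMeasure (kernelMeasure η) := by
  refine ⟨?_⟩
  have hi : Integrable η := hη.smooth.continuous.integrable_of_hasCompactSupport
    hη.hasCompactSupport
  rw [kernelMeasure, withDensity_apply _ MeasurableSet.univ, Measure.restrict_univ,
    ← ofReal_integral_eq_lintegral_ofReal hi (Eventually.of_forall hη.nonneg),
    hη.integral_eq_one, ENNReal.ofReal_one]

lemma kernelMeasure_absolutelyContinuous (η : EuclideanSpace ℝ (Fin n) → ℝ) :
    kernelMeasure η ≪ volume := withDensity_absolutelyContinuous _ _

lemma IsMollifier.integral_kernelMeasure (hη : IsMollifier η)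
    (g : EuclideanSpace ℝ (Fin n) → ℝ) : ∫ z, g z ∂(kernelMeasure η) = ∫ z, η z * g z := by
  rw [kernelMeasure, integral_withDensity_eq_integral_toReal_smul
    (hη.smooth.continuous.measurable.ennreal_ofReal)
    (Eventually.of_forall fun _ => ENNReal.ofReal_lt_top)]
  simp only [ENNReal.toReal_ofReal (hη.nonneg _), smul_eq_mul]

lemma IsMollifier.ae_norm_le (hη : IsMollifier η) : ∀ᵐ z ∂(kernelMeasure η), ‖z‖ ≤ 1 := by
  rw [kernelMeasure, ae_withDensity_iff hη.smooth.continuous.measurable.ennreal_ofReal]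
  refine Eventually.of_forall fun z hz => ?_
  have : z ∈ Function.support η := fun h => hz (by rw [h, ENNReal.ofReal_zero])
  simpa using hη.support_subset this

lemma IsMollifier.integrable_of_continuous (hη : IsMollifier η)
    {g : EuclideanSpace ℝ (Fin n) → ℝ} (hg : Continuous g) : Integrable g (kernelMeasure η) := by
  have := hη.isProbabilityMeasure
  obtain ⟨C, hC⟩ := (isCompact_closedBall (0 : EuclideanSpace ℝ (Fin n))
    1).exists_bound_of_continuousOn hg.continuousOn
  refine Integrable.of_bound hg.aestronglyMeasurable C ?_
  filter_upwards [hη.ae_norm_le] with z hz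
  exact hC z (by simpa using hz)

/-- The mollification is an average of translates of `f`. -/
lemma IsMollifier.mollify_eq (hη : IsMollifier η) (f : EuclideanSpace ℝ (Fin n) → ℝ) {h : ℝ}
    (hh : 0 < h) (x : EuclideanSpace ℝ (Fin n)) :
    mollify η f h x = ∫ z, f (x - h • z) ∂(kernelMeasure η) := by
  rw [mollify, ← integral_sub_left_eq_self _ volume x, hη.integral_kernelMeasure]
  have := Measure.integral_comp_inv_smul (volume : Measure (EuclideanSpace ℝ (Fin n)))
    (fun z => η z * f (x - h • z)) h
  simp only [smul_inv_smul₀ hh.ne', finrank_euclideanSpace, Fintype.card_fin,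
    abs_of_pos (pow_pos hh n), smul_eq_mul] at this
  simp only [sub_sub_cancel]
  have e : ∀ y, f (x - y) * η (h⁻¹ • y) = η (h⁻¹ • y) * f (x - y) := fun y => mul_comm _ _
  simp only [e, this]
  rw [← mul_assoc, inv_mul_cancel₀ (pow_pos hh n).ne', one_mul]

lemma mollify_periodic (hf : IsPeriodic f) (h : ℝ) : IsPeriodic (mollify η f h) := by
  intro i x
  unfold mollify
  congr 1
  rw [← integral_add_right_eq_self _ (EuclideanSpace.single i (2 : ℝ))]
  simp only [hf i, add_sub_add_right_eq_sub]

lemma IsMollifier.secondDiff_mollify (hη : IsMollifier η) (hf : Continuous f) {h : ℝ}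
    (hh : 0 < h) (x v : EuclideanSpace ℝ (Fin n)) :
    secondDiff (mollify η f h) x v = ∫ z, secondDiff f (x - h • z) v ∂(kernelMeasure η) := by
  simp only [secondDiff, hη.mollify_eq f hh]
  rw [integral_sub, integral_add, integral_const_mul]
  · simp only [add_sub_right_comm, sub_right_comm x v]
  all_goals exact hη.integrable_of_continuous (by fun_prop)

/-- The potential of `θ f_h` is the convex combination of the mollified potential and of
`|x|² / 2`, up to an affine function that second differences do not see. -/
lemma IsMollifier.secondDiff_potential_mollify (hη : IsMollifier η) (hf : Continuous f) {h : ℝ}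
    (hh : 0 < h) (θ : ℝ) (x v : EuclideanSpace ℝ (Fin n)) :
    secondDiff (potential fun y => θ * mollify η f h y) x v =
      θ * ∫ z, secondDiff (potential f) (x - h • z) v ∂(kernelMeasure η) + (1 - θ) * ‖v‖ ^ 2 := by
  have := hη.isProbabilityMeasure
  have h1 : secondDiff (fun y => θ * mollify η f h y) x v
      = θ * secondDiff (mollify η f h) x v := by
    simp only [secondDiff]
    ring
  have h2 : Integrable (fun z => secondDiff f (x - h • z) v) (kernelMeasure η) :=
    hη.integrable_of_continuous (by unfold secondDiff; fun_prop)
  rw [secondDiff_potential, h1, hη.secondDiff_mollify hf hh]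
  simp only [secondDiff_potential]
  rw [integral_add h2 (integrable_const _)]
  simp
  ring

/-- The Hessian of the potential of `θ f_h` dominates the corresponding average of the pointwise
Hessians of `u`: the singular part of the second derivative of a convex function is nonnegative,
which here is Fatou's lemma for second difference quotients. -/
lemma IsMollifier.le_quadForm_of_hasHessianAt (hη : IsMollifier η) (hf : Continuous f)
    (hconv : ∀ x v, 0 ≤ secondDiff (potential f) x v)
    (hD : ∀ᵐ y, ∃ A, HasHessianAt (potential f) A y) {h : ℝ} (hh : 0 < h) {θ : ℝ} (hθ : 0 < θ)
    {x : EuclideanSpace ℝ (Fin n)} {C : Matrix (Fin n) (Fin n) ℝ}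
    (hC : HasHessianAt (potential fun y => θ * mollify η f h y) C x)
    (v : EuclideanSpace ℝ (Fin n)) :
    Integrable (fun z => quadForm (hessian (potential f) (x - h • z)) v) (kernelMeasure η) ∧
      θ * ∫ z, quadForm (hessian (potential f) (x - h • z)) v ∂(kernelMeasure η)
        + (1 - θ) * ‖v‖ ^ 2 ≤ quadForm C v := by
  have hD' : ∀ᵐ z ∂(kernelMeasure η), ∃ A, HasHessianAt (potential f) A (x - h • z) := by
    refine (kernelMeasure_absolutelyContinuous η).ae_le ?_
    exact (quasiMeasurePreserving_sub_smul hh.ne' x).ae hD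
  have hlim := (((hC.tendsto_secondDiff v).comp tendsto_step).sub_const
    ((1 - θ) * ‖v‖ ^ 2)).div_const θ
  have hval : ∀ k, ∫ z, secondDiff (potential f) (x - h • z) (step k • v) / step k ^ 2
      ∂(kernelMeasure η) = (secondDiff (potential fun y => θ * mollify η f h y) x (step k • v)
        / step k ^ 2 - (1 - θ) * ‖v‖ ^ 2) / θ := by
    intro k
    have := (step_pos k).ne'
    rw [hη.secondDiff_potential_mollify hf hh, integral_div, norm_smul, mul_pow,
      Real.norm_eq_abs, sq_abs]
    field_simp
    ring
  have key : ∀ δ > 0,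
      Integrable (fun z => quadForm (hessian (potential f) (x - h • z)) v) (kernelMeasure η) ∧
      ∫ z, quadForm (hessian (potential f) (x - h • z)) v ∂(kernelMeasure η)
        ≤ (quadForm C v - (1 - θ) * ‖v‖ ^ 2) / θ + δ := by
    intro δ hδ
    refine integrable_and_integral_le_of_tendsto
      (F := fun k z => secondDiff (potential f) (x - h • z) (step k • v) / step k ^ 2)
      (fun k => hη.integrable_of_continuous ?_) (fun k => ?_) ?_ (Eventually.frequently ?_)
    · have := continuous_potential hf
      unfold secondDiff
      fun_prop
    · exact Eventually.of_forall fun x => div_nonneg (hconv _ _) (sq_nonneg _)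
    · filter_upwards [hD'] with z hz
      exact ((hasHessianAt_hessian hz).tendsto_secondDiff v).comp tendsto_step
    · filter_upwards [hlim.eventually_le_const (lt_add_of_pos_right _ hδ)] with k hk
      rw [hval]
      exact hk
  refine ⟨(key 1 one_pos).1, ?_⟩
  have h3 := le_of_forall_pos_le_add fun δ hδ => (key δ hδ).2
  rw [le_div_iff₀ hθ] at h3
  linarith

end Mollification

/-! ### Convergence of mollified Hessians -/

/-- Second-order Taylor expansion of a `C²` function. -/
lemma exists_hasHessianAt_of_contDiff {w : EuclideanSpace ℝ (Fin n) → ℝ} (hw : ContDiff ℝ 2 w)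
    (x : EuclideanSpace ℝ (Fin n)) : ∃ A, HasHessianAt w A x ∧
      ∀ v, quadForm A v = fderiv ℝ (fderiv ℝ w) x v v := by
  set D := fderiv ℝ (fderiv ℝ w) x
  have hsymm : ∀ a b, D a b = D b a := fun a b =>
    (hw.contDiffAt.isSymmSndFDerivAt (by simp)).eq a b
  have hquad : ∀ v, quadForm (Matrix.of fun i j =>
      D (EuclideanSpace.single i 1) (EuclideanSpace.single j 1)) v = D v v := by
    intro v
    have hv : v = ∑ i, v i • EuclideanSpace.single i (1 : ℝ) := by
      ext j
      simp [Pi.single_apply]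
    conv_rhs => rw [hv]
    simp [quadForm_eq_sum, Finset.mul_sum]
    rw [Finset.sum_comm]
    refine Finset.sum_congr rfl fun i _ => Finset.sum_congr rfl fun j _ => ?_
    ring
  refine ⟨Matrix.of fun i j => D (EuclideanSpace.single i 1) (EuclideanSpace.single j 1),
    ⟨Matrix.IsSymm.ext fun i j => hsymm _ _,
      (InnerProductSpace.toDual ℝ _).symm (fderiv ℝ w x), ?_⟩, hquad⟩
  have hd1 : ∀ y, HasFDerivAt w (fderiv ℝ w y) y := fun y =>
    (hw.differentiable (by norm_num) y).hasFDerivAt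
  have hd2 : HasFDerivAt (fderiv ℝ w) D x :=
    ((hw.fderiv_right (m := 1) (by norm_num)).differentiable (by norm_num) x).hasFDerivAt
  refine IsLittleO.of_bound fun c hc => ?_
  have hb := (hasFDerivAt_iff_isLittleO.mp hd2).def hc
  rw [Metric.eventually_nhds_iff] at hb
  obtain ⟨δ, hδ, hb⟩ := hb
  filter_upwards [Metric.ball_mem_nhds x hδ] with y hy
  rw [Metric.mem_ball] at hy
  let T : EuclideanSpace ℝ (Fin n) → ℝ := fun z =>
    w z - fderiv ℝ w x (z - x) - 1 / 2 * D (z - x) (z - x)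
  have hT : ∀ z, HasFDerivAt T (fderiv ℝ w z - fderiv ℝ w x - D (z - x)) z := by
    intro z
    have hid : HasFDerivAt (fun z => z - x) (ContinuousLinearMap.id ℝ _) z :=
      (hasFDerivAt_id z).sub_const x
    have h1 := ((hd1 z).sub ((fderiv ℝ w x).hasFDerivAt.comp z hid)).sub
      (((D.hasFDerivAt.comp z hid).clm_apply hid).const_mul (1 / 2))
    refine h1.congr_fderiv ?_
    ext v
    simp
    rw [hsymm v z, hsymm v x]
    ring
  have hle := (convex_closedBall x (dist y x)).norm_image_sub_le_of_norm_hasFDerivWithin_le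
    (f := T) (C := c * ‖y - x‖) (fun z _ => (hT z).hasFDerivWithinAt)
    (fun z hz => by
      rw [Metric.mem_closedBall] at hz
      refine (hb (hz.trans_lt hy)).trans ?_
      rw [← dist_eq_norm, ← dist_eq_norm]
      gcongr)
    (Metric.mem_closedBall_self dist_nonneg) (Metric.mem_closedBall.mpr le_rfl)
  have hTe : T y - T x = w y - w x - fderiv ℝ w x (y - x) - 1 / 2 * D (y - x) (y - x) := by
    simp only [T, sub_self, map_zero]
    ring
  have hq := hquad (y - x)
  rw [quadForm] at hq
  rw [hq, InnerProductSpace.toDual_symm_apply, ← hTe]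
  refine hle.trans (le_of_eq ?_)
  simp
  ring

lemma two_le_infty : (2 : WithTop ℕ∞) ≤ ((⊤ : ℕ∞) : WithTop ℕ∞) :=
  WithTop.coe_le_coe.mpr (le_top : (2 : ℕ∞) ≤ ⊤)

section MollifiedDerivatives

variable {η f : EuclideanSpace ℝ (Fin n) → ℝ}

/-- The pure second derivative of `φ` along `v`. -/
def secondDeriv (φ : EuclideanSpace ℝ (Fin n) → ℝ) (v : EuclideanSpace ℝ (Fin n)) :
    EuclideanSpace ℝ (Fin n) → ℝ :=
  fun y => fderiv ℝ (fun z => fderiv ℝ φ z v) y v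

lemma contDiff_fderiv_apply {φ : EuclideanSpace ℝ (Fin n) → ℝ} (hφ : ContDiff ℝ ∞ φ)
    (v : EuclideanSpace ℝ (Fin n)) : ContDiff ℝ ∞ fun z => fderiv ℝ φ z v :=
  (hφ.fderiv_right (m := ∞) (by simp)).clm_apply contDiff_const

lemma fderiv_convolution_apply {φ g : EuclideanSpace ℝ (Fin n) → ℝ} (hφ : ContDiff ℝ ∞ φ)
    (hφc : HasCompactSupport φ) (hg : Continuous g) (x v : EuclideanSpace ℝ (Fin n)) :
    fderiv ℝ (convolution g φ (ContinuousLinearMap.mul ℝ ℝ) volume) x v =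
      convolution g (fun z => fderiv ℝ φ z v) (ContinuousLinearMap.mul ℝ ℝ) volume x := by
  rw [(hφc.hasFDerivAt_convolution_right (ContinuousLinearMap.mul ℝ ℝ) hg.locallyIntegrable
    (hφ.of_le (by simp)) x).fderiv]
  exact convolution_precompR_apply (ContinuousLinearMap.mul ℝ ℝ) hg.locallyIntegrable
    (hφc.fderiv ℝ) (hφ.continuous_fderiv (by simp)) x v

lemma secondDeriv_convolution {φ g : EuclideanSpace ℝ (Fin n) → ℝ} (hφ : ContDiff ℝ ∞ φ)
    (hφc : HasCompactSupport φ) (hg : Continuous g) (x v : EuclideanSpace ℝ (Fin n)) :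
    secondDeriv (convolution g φ (ContinuousLinearMap.mul ℝ ℝ) volume) v x =
      ∫ z, g (x - z) * secondDeriv φ v z := by
  unfold secondDeriv
  simp only [fderiv_convolution_apply hφ hφc hg]
  rw [fderiv_convolution_apply (contDiff_fderiv_apply hφ v) (hφc.fderiv_apply ℝ v) hg,
    convolution_eq_swap]
  rfl

lemma IsMollifier.mollify_eq_convolution (hη : IsMollifier η)
    (f : EuclideanSpace ℝ (Fin n) → ℝ) {h : ℝ} (hh : 0 < h) :
    mollify η f h = fun x => convolution (fun w => f (h • w)) η
      (ContinuousLinearMap.mul ℝ ℝ) volume (h⁻¹ • x) := by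
  ext x
  rw [hη.mollify_eq f hh, hη.integral_kernelMeasure, convolution_eq_swap]
  refine integral_congr_ae (Eventually.of_forall fun z => ?_)
  simp only [ContinuousLinearMap.mul_apply', smul_sub, smul_inv_smul₀ hh.ne']
  ring

lemma IsMollifier.contDiff_mollify (hη : IsMollifier η) (hf : Continuous f) {h : ℝ}
    (hh : 0 < h) : ContDiff ℝ ∞ (mollify η f h) := by
  rw [hη.mollify_eq_convolution f hh]
  have : ContDiff ℝ ∞ (convolution (fun w => f (h • w)) η
      (ContinuousLinearMap.mul ℝ ℝ) volume) :=
    hη.hasCompactSupport.contDiff_convolution_right (ContinuousLinearMap.mul ℝ ℝ)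
      (by fun_prop : Continuous fun w => f (h • w)).locallyIntegrable hη.smooth
  exact this.comp (contDiff_const_smul _)

/-- The Hessian of a mollification, with both derivatives falling on the kernel. -/
lemma IsMollifier.quadForm_hessian_mollify (hη : IsMollifier η) (hf : Continuous f) {h : ℝ}
    (hh : 0 < h) {x : EuclideanSpace ℝ (Fin n)} {B : Matrix (Fin n) (Fin n) ℝ}
    (hB : HasHessianAt (mollify η f h) B x) (v : EuclideanSpace ℝ (Fin n)) :
    quadForm B v = (h ^ 2)⁻¹ * ∫ z, f (x - h • z) * secondDeriv η v z := by
  have hg : Continuous fun w => f (h • w) := by fun_prop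
  have hG : ContDiff ℝ 2 (convolution (fun w => f (h • w)) η
      (ContinuousLinearMap.mul ℝ ℝ) volume) :=
    hη.hasCompactSupport.contDiff_convolution_right (n := 2) (ContinuousLinearMap.mul ℝ ℝ)
      hg.locallyIntegrable (hη.smooth.of_le two_le_infty)
  obtain ⟨A, hA, hAv⟩ := exists_hasHessianAt_of_contDiff hG (h⁻¹ • x)
  have h2 : fderiv ℝ (fderiv ℝ (convolution (fun w => f (h • w)) η
      (ContinuousLinearMap.mul ℝ ℝ) volume)) (h⁻¹ • x) v v
      = ∫ z, f (x - h • z) * secondDeriv η v z := by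
    have h3 := secondDeriv_convolution hη.smooth hη.hasCompactSupport hg (h⁻¹ • x) v
    simp only [smul_sub, smul_inv_smul₀ hh.ne'] at h3
    rw [← h3, secondDeriv]
    have hd := ((hG.fderiv_right (m := 1) (by norm_num)).differentiable (by norm_num)
      (h⁻¹ • x)).hasFDerivAt.clm_apply (hasFDerivAt_const v (h⁻¹ • x))
    rw [hd.fderiv]
    simp
  rw [← h2, ← hAv]
  have hs : ∀ t : ℝ, secondDiff (mollify η f h) x (t • v)
      = secondDiff (convolution (fun w => f (h • w)) η
        (ContinuousLinearMap.mul ℝ ℝ) volume) (h⁻¹ • x) (t • (h⁻¹ • v)) := by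
    intro t
    simp only [secondDiff, hη.mollify_eq_convolution f hh, smul_add, smul_sub,
      smul_comm t h⁻¹ v]
  have hl := hB.tendsto_secondDiff v
  simp only [hs] at hl
  rw [tendsto_nhds_unique hl (hA.tendsto_secondDiff (h⁻¹ • v)), quadForm_smul, inv_pow]

/-- Mollifying a quadratic polynomial does not change its Hessian. -/
lemma IsMollifier.quadForm_hessian_mollify_quadratic (hη : IsMollifier η)
    {T : EuclideanSpace ℝ (Fin n) → ℝ} (hT : Continuous T) {A : Matrix (Fin n) (Fin n) ℝ}
    (hTA : ∀ x v, secondDiff T x v = quadForm A v) {h : ℝ}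
    (hh : 0 < h) {x : EuclideanSpace ℝ (Fin n)} {B : Matrix (Fin n) (Fin n) ℝ}
    (hB : HasHessianAt (mollify η T h) B x) (v : EuclideanSpace ℝ (Fin n)) :
    quadForm B v = quadForm A v := by
  have := hη.isProbabilityMeasure
  have hl := hB.tendsto_secondDiff v
  refine tendsto_nhds_unique hl (Tendsto.congr' ?_ tendsto_const_nhds)
  filter_upwards [self_mem_nhdsWithin] with t ht
  have ht : t ^ 2 ≠ 0 := pow_ne_zero 2 ht
  rw [hη.secondDiff_mollify hT hh]
  simp only [hTA, integral_const, probReal_univ, one_smul, quadForm_smul]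
  rw [mul_div_cancel_left₀ _ ht]

/-- At a point where `f` has a second-order Taylor expansion, the Hessians of its mollifications
converge to the Hessian of `f`. -/
lemma IsMollifier.tendsto_quadForm_hessian_mollify (hη : IsMollifier η) (hf : Continuous f)
    {x : EuclideanSpace ℝ (Fin n)} {A : Matrix (Fin n) (Fin n) ℝ} (hA : HasHessianAt f A x)
    (v : EuclideanSpace ℝ (Fin n)) :
    Tendsto (fun h => quadForm (hessian (mollify η f h) x) v) (𝓝[>] 0) (𝓝 (quadForm A v)) := by
  obtain ⟨hsymm, p, hp⟩ := hA
  let T : EuclideanSpace ℝ (Fin n) → ℝ := fun y =>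
    f x + inner ℝ p (y - x) + 1 / 2 * quadForm A (y - x)
  have hTc : Continuous T := by
    simp only [T, quadForm_eq_sum]
    fun_prop
  have hT2 : ∀ y w, secondDiff T y w = quadForm A w := by
    intro y w
    simp only [secondDiff, T, quadForm, WithLp.ofLp_add, WithLp.ofLp_sub,
      Matrix.mulVec_add, Matrix.mulVec_sub, dotProduct_add, dotProduct_sub, add_dotProduct,
      sub_dotProduct, inner_add_right, inner_sub_right]
    ring
  have hess : ∀ {g : EuclideanSpace ℝ (Fin n) → ℝ}, Continuous g → ∀ {h : ℝ}, 0 < h →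
      HasHessianAt (mollify η g h) (hessian (mollify η g h) x) x := by
    intro g hg h hh
    obtain ⟨B, hB, -⟩ := exists_hasHessianAt_of_contDiff
      ((hη.contDiff_mollify hg hh).of_le two_le_infty) x
    exact hasHessianAt_hessian ⟨B, hB⟩
  have hsd : Continuous (secondDeriv η v) :=
    (contDiff_fderiv_apply (contDiff_fderiv_apply hη.smooth v) v).continuous
  have hsc : HasCompactSupport (secondDeriv η v) :=
    (hη.hasCompactSupport.fderiv_apply ℝ v).fderiv_apply ℝ v
  set K := ∫ z, ‖secondDeriv η v z‖ with hK
  have hK0 : 0 ≤ K := integral_nonneg fun z => norm_nonneg _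
  rw [Metric.tendsto_nhds]
  intro ε hε
  have hc : 0 < ε / (K + 1) := by positivity
  have hb := hp.def hc
  rw [Metric.eventually_nhds_iff] at hb
  obtain ⟨δ, hδ, hb⟩ := hb
  filter_upwards [self_mem_nhdsWithin, nhdsWithin_le_nhds (Iio_mem_nhds hδ)] with h hh hhδ
  have hh : 0 < h := hh
  have hint : ∀ {g : EuclideanSpace ℝ (Fin n) → ℝ}, Continuous g →
      Integrable fun z => g (x - h • z) * secondDeriv η v z := fun {g} hg =>
    ((by fun_prop : Continuous fun z => g (x - h • z) * secondDeriv η v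
      z)).integrable_of_hasCompactSupport hsc.mul_left
  have hdiff : quadForm (hessian (mollify η f h) x) v - quadForm A v
      = (h ^ 2)⁻¹ * ∫ z, (f (x - h • z) - T (x - h • z)) * secondDeriv η v z := by
    rw [← hη.quadForm_hessian_mollify_quadratic hTc hT2 hh (hess hTc hh) v,
      hη.quadForm_hessian_mollify hf hh (hess hf hh), hη.quadForm_hessian_mollify hTc hh
      (hess hTc hh), ← mul_sub, ← integral_sub (hint hf) (hint hTc)]
    simp only [sub_mul]
  have hbound : ∀ z, ‖(f (x - h • z) - T (x - h • z)) * secondDeriv η v z‖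
      ≤ ε / (K + 1) * h ^ 2 * ‖secondDeriv η v z‖ := by
    intro z
    rw [norm_mul]
    by_cases hz : ‖z‖ ≤ 1
    · refine mul_le_mul_of_nonneg_right ?_ (norm_nonneg _)
      have hn : ‖x - h • z - x‖ ≤ h := by
        rw [sub_sub_cancel_left, norm_neg, norm_smul, Real.norm_of_nonneg hh.le]
        exact mul_le_of_le_one_right hh.le hz
      have h1 := hb (y := x - h • z) (by rw [dist_eq_norm]; exact hn.trans_lt hhδ)
      have e : f (x - h • z) - T (x - h • z) = f (x - h • z) - f x - inner ℝ p (x - h • z - x)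
          - 1 / 2 * ((x - h • z - x).ofLp ⬝ᵥ (A *ᵥ (x - h • z - x).ofLp)) := by
        simp only [T, quadForm]
        ring
      rw [e]
      refine h1.trans (mul_le_mul_of_nonneg_left ?_ hc.le)
      rw [Real.norm_of_nonneg (sq_nonneg _)]
      exact pow_le_pow_left₀ (norm_nonneg _) hn 2
    · have hz0 : secondDeriv η v z = 0 := by
        by_contra hne
        have hts : tsupport η ⊆ Metric.closedBall 0 1 :=
          closure_minimal hη.support_subset Metric.isClosed_closedBall
        have hz1 : z ∈ tsupport (secondDeriv η v) := subset_tsupport _ hne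
        have hz2 := hts (tsupport_fderiv_apply_subset ℝ v
          (tsupport_fderiv_apply_subset ℝ v hz1))
        exact hz (by simpa using hz2)
      simp [hz0]
  have hI : ‖∫ z, (f (x - h • z) - T (x - h • z)) * secondDeriv η v z‖
      ≤ ε / (K + 1) * h ^ 2 * K := by
    rw [hK, ← integral_const_mul]
    exact norm_integral_le_of_norm_le
      ((hsd.integrable_of_hasCompactSupport hsc).norm.const_mul _)
      (Eventually.of_forall hbound)
  rw [Real.dist_eq, hdiff, abs_mul, abs_of_pos (by positivity)]
  rw [Real.norm_eq_abs] at hI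
  calc (h ^ 2)⁻¹ * |∫ z, (f (x - h • z) - T (x - h • z)) * secondDeriv η v z|
      ≤ (h ^ 2)⁻¹ * (ε / (K + 1) * h ^ 2 * K) := by gcongr
    _ = ε * (K / (K + 1)) := by field_simp
    _ < ε := by
        refine mul_lt_of_lt_one_right hε ?_
        rw [div_lt_one (by positivity)]
        linarith

end MollifiedDerivatives

/-! ### The integral of `log det` -/

section LogDet

variable {u f : EuclideanSpace ℝ (Fin n) → ℝ}

lemma logDetHessian_eq {x : EuclideanSpace ℝ (Fin n)} (h : 0 < (hessian u x).det) :
    logDetHessian u x = ((Real.log (hessian u x).det : ℝ) : EReal) :=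
  ENNReal.log_ofReal_of_pos h

lemma toENNReal_coe (a : ℝ) : (a : EReal).toENNReal = ENNReal.ofReal a := by
  rw [EReal.toENNReal_of_ne_top (EReal.coe_ne_top a), EReal.toReal_coe]

/-- When `log det D²u` is finite almost everywhere and integrable, its extended integral is the
Bochner integral. -/
lemma logDetIntegral_eq (hdet : ∀ᵐ x ∂(volume.restrict (P n)), 0 < (hessian u x).det)
    (hint : IntegrableOn (fun x => Real.log (hessian u x).det) (P n)) :
    logDetIntegral u = ((∫ x in P n, Real.log (hessian u x).det : ℝ) : EReal) := by
  have h1 : ∫⁻ x in P n, (logDetHessian u x).toENNReal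
      = ∫⁻ x in P n, ENNReal.ofReal (Real.log (hessian u x).det) := by
    refine lintegral_congr_ae ?_
    filter_upwards [hdet] with x hx
    rw [logDetHessian_eq hx, toENNReal_coe]
  have h2 : ∫⁻ x in P n, (-logDetHessian u x).toENNReal
      = ∫⁻ x in P n, ENNReal.ofReal (-Real.log (hessian u x).det) := by
    refine lintegral_congr_ae ?_
    filter_upwards [hdet] with x hx
    rw [logDetHessian_eq hx, ← EReal.coe_neg, toENNReal_coe]
  have h3 : ∫⁻ x in P n, ENNReal.ofReal (Real.log (hessian u x).det) ≠ ⊤ :=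
    (hint.lintegral_lt_top).ne
  have h4 : ∫⁻ x in P n, ENNReal.ofReal (-Real.log (hessian u x).det) ≠ ⊤ :=
    (hint.neg.lintegral_lt_top).ne
  rw [logDetIntegral, h1, h2, integral_eq_lintegral_pos_part_sub_lintegral_neg_part hint,
    EReal.coe_sub, EReal.coe_ennreal_toReal h3, EReal.coe_ennreal_toReal h4]

lemma lintegral_neg_logDetHessian_ne_top (h : ⊥ < logDetIntegral u) :
    ∫⁻ x in P n, (-logDetHessian u x).toENNReal ≠ ⊤ := by
  intro ht
  rw [logDetIntegral, ht, EReal.coe_ennreal_top, sub_eq_add_neg, EReal.neg_top,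
    EReal.add_bot] at h
  exact lt_irrefl _ h

/-- If the integral of `log det D²u` is not `-∞`, then the Hessian exists and is nondegenerate at
almost every point of `P`. -/
lemma ae_hasHessianAt_and_det_pos (hu : Continuous u) (h : ⊥ < logDetIntegral u) :
    ∀ᵐ x ∂(volume.restrict (P n)), (∃ A, HasHessianAt u A x) ∧ 0 < (hessian u x).det := by
  have hm : Measurable fun x => (-logDetHessian u x).toENNReal := by
    have := (measurable_det_hessian hu).ennreal_ofReal
    unfold logDetHessian
    fun_prop
  filter_upwards [ae_lt_top hm (lintegral_neg_logDetHessian_ne_top h)] with x hx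
  have hdet : 0 < (hessian u x).det := by
    by_contra hneg
    rw [logDetHessian, ENNReal.ofReal_of_nonpos (not_lt.mp hneg), ENNReal.log_zero,
      EReal.neg_bot, EReal.toENNReal_top] at hx
    exact lt_irrefl _ hx
  refine ⟨?_, hdet⟩
  -- In dimension zero the zero matrix has determinant `1`, but there every point has a Hessian.
  rcases Nat.eq_zero_or_pos n with rfl | hn
  · refine ⟨0, Matrix.isSymm_zero, 0, ?_⟩
    have : ∀ y : EuclideanSpace ℝ (Fin 0), y = x := fun y => Subsingleton.elim _ _
    refine (isLittleO_zero _ _).congr_left fun y => ?_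
    simp [this y]
  · by_contra hne
    have : Nonempty (Fin n) := ⟨⟨0, hn⟩⟩
    rw [hessian, dif_neg hne, Matrix.det_zero] at hdet
    exact lt_irrefl _ hdet

lemma quadForm_hessian_nonneg (hconv : ∀ x v, 0 ≤ secondDiff u x v)
    (x v : EuclideanSpace ℝ (Fin n)) : 0 ≤ quadForm (hessian u x) v := by
  by_cases hx : ∃ A, HasHessianAt u A x
  · exact (hasHessianAt_hessian hx).quadForm_nonneg (hconv x) v
  · rw [hessian, dif_neg hx]
    simp [quadForm]

lemma posSemidef_hessian (hconv : ∀ x v, 0 ≤ secondDiff u x v)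
    (x : EuclideanSpace ℝ (Fin n)) : (hessian u x).PosSemidef := by
  refine posSemidef_of_quadForm_nonneg ?_ (quadForm_hessian_nonneg hconv x)
  by_cases hx : ∃ A, HasHessianAt u A x
  · exact (hasHessianAt_hessian hx).1
  · rw [hessian, dif_neg hx]
    exact Matrix.isSymm_zero

lemma integral_trace_hessian_le (hf : IsPeriodic f)
    (hc : Continuous f) (hconv : ∀ x v, 0 ≤ secondDiff (potential f) x v)
    (hD : ∀ᵐ x ∂(volume.restrict (P n)), ∃ A, HasHessianAt (potential f) A x) :
    IntegrableOn (fun x => (hessian (potential f) x).trace) (P n) ∧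
      ∫ x in P n, (hessian (potential f) x).trace ≤ n * volume.real (P n) := by
  have h := fun i : Fin n =>
    integral_quadForm_hessian_le hf hc hconv hD (EuclideanSpace.single i 1)
  simp only [trace_eq_sum_quadForm]
  refine ⟨integrable_finsetSum _ fun i _ => (h i).1, ?_⟩
  rw [integral_finsetSum _ fun i _ => (h i).1]
  calc ∑ i, ∫ x in P n, quadForm (hessian (potential f) x) (EuclideanSpace.single i 1)
      ≤ ∑ _i : Fin n, volume.real (P n) :=
        Finset.sum_le_sum fun i _ => (h i).2.trans (by simp)
    _ = n * volume.real (P n) := by simp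

/-- Finiteness of the negative part is the hypothesis; the positive part is controlled by the
trace, whose mean is bounded by periodicity. -/
lemma integrableOn_log_det (hf : IsPeriodic f)
    (hc : Continuous f) (hconv : ∀ x v, 0 ≤ secondDiff (potential f) x v)
    (h : ⊥ < logDetIntegral (potential f)) :
    IntegrableOn (fun x => Real.log (hessian (potential f) x).det) (P n) := by
  have hu := continuous_potential hc
  have hae := ae_hasHessianAt_and_det_pos hu h
  have htr := (integral_trace_hessian_le hf hc hconv (hae.mono fun x hx => hx.1)).1
  have hm : Measurable fun x => Real.log (hessian (potential f) x).det :=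
    (measurable_det_hessian hu).log
  refine ⟨hm.aestronglyMeasurable, ?_⟩
  rw [hasFiniteIntegral_iff_norm]
  have hneg : ∫⁻ x in P n, ENNReal.ofReal (-Real.log (hessian (potential f) x).det) ≠ ⊤ := by
    refine ne_of_eq_of_ne (lintegral_congr_ae ?_) (lintegral_neg_logDetHessian_ne_top h)
    filter_upwards [hae] with x hx
    rw [logDetHessian_eq hx.2, ← EReal.coe_neg, toENNReal_coe]
  have hle : ∫⁻ x in P n, ENNReal.ofReal ‖Real.log (hessian (potential f) x).det‖ ≤
      ∫⁻ x in P n, (ENNReal.ofReal (hessian (potential f) x).trace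
        + ENNReal.ofReal (-Real.log (hessian (potential f) x).det)) := by
    refine lintegral_mono_ae ?_
    filter_upwards [hae] with x hx
    have h1 := log_det_le_trace (posSemidef_hessian hconv x) hx.2 one_pos
    rw [Real.log_one, mul_zero, neg_zero, zero_add, one_mul] at h1
    have h2 : (0 : ℝ) ≤ n := Nat.cast_nonneg n
    rw [Real.norm_eq_abs]
    rcases le_total 0 (Real.log (hessian (potential f) x).det) with h0 | h0
    · rw [abs_of_nonneg h0]
      exact le_add_right (ENNReal.ofReal_le_ofReal (by linarith))
    · rw [abs_of_nonpos h0]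
      exact le_add_left le_rfl
  refine hle.trans_lt ?_
  have hm' : Measurable fun x =>
      ENNReal.ofReal (-Real.log (hessian (potential f) x).det) := hm.neg.ennreal_ofReal
  rw [lintegral_add_right _ hm']
  exact ENNReal.add_lt_top.mpr ⟨htr.lintegral_lt_top, hneg.lt_top⟩

end LogDet

/-! ### The `log det` integrals of the approximations -/

section Approximation

variable {η f : EuclideanSpace ℝ (Fin n) → ℝ}

/-- Averaging the translates of a periodic function does not change its integral over `P`. -/
lemma integral_average_translates {F : EuclideanSpace ℝ (Fin n) → ℝ} (hF : IsPeriodic F)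
    (hm : Measurable F) (hint : IntegrableOn F (P n)) (ν : Measure (EuclideanSpace ℝ (Fin n)))
    [IsProbabilityMeasure ν] (h : ℝ) :
    (∀ᵐ x ∂(volume.restrict (P n)), Integrable (fun z => F (x - h • z)) ν) ∧
      IntegrableOn (fun x => ∫ z, F (x - h • z) ∂ν) (P n) ∧
      ∫ x in P n, ∫ z, F (x - h • z) ∂ν = ∫ x in P n, F x := by
  have hi : Integrable (fun p : EuclideanSpace ℝ (Fin n) × EuclideanSpace ℝ (Fin n) =>
      F (p.1 - h • p.2)) ((volume.restrict (P n)).prod ν) := by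
    have hm' : Measurable fun p : EuclideanSpace ℝ (Fin n) × EuclideanSpace ℝ (Fin n) =>
        F (p.1 - h • p.2) := hm.comp (by fun_prop)
    refine (integrable_prod_iff' hm'.aestronglyMeasurable).mpr
      ⟨Eventually.of_forall fun z => ?_, ?_⟩
    · simpa only [sub_eq_add_neg, IntegrableOn] using hF.integrableOn_add (-(h • z)) hint
    · have hN : IsPeriodic fun x => ‖F x‖ := fun i x => by simp only [hF i x]
      have : ∀ z, ∫ x in P n, ‖F (x - h • z)‖ = ∫ x in P n, ‖F x‖ := fun z => by
        simpa only [sub_eq_add_neg] using hN.setIntegral_add (-(h • z))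
      simp only [this]
      exact integrable_const _
  refine ⟨hi.prod_right_ae, hi.integral_prod_left, ?_⟩
  rw [integral_integral_swap hi]
  have : ∀ z, ∫ x in P n, F (x - h • z) = ∫ x in P n, F x := fun z => by
    simpa only [sub_eq_add_neg] using hF.setIntegral_add (-(h • z))
  simp [this]

lemma exists_hasHessianAt_potential_mollify (hη : IsMollifier η) (hc : Continuous f) {h : ℝ}
    (hh : 0 < h) (θ : ℝ) (x : EuclideanSpace ℝ (Fin n)) :
    ∃ A, HasHessianAt (potential fun y => θ * mollify η f h y) A x := by
  have h1 : ContDiff ℝ 2 (mollify η f h) := (hη.contDiff_mollify hc hh).of_le two_le_infty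
  have h2 : ContDiff ℝ 2 (potential fun y => θ * mollify η f h y) := by
    unfold potential
    fun_prop
  obtain ⟨A, hA, -⟩ := exists_hasHessianAt_of_contDiff h2 x
  exact ⟨A, hA⟩

variable {h θ : ℝ}

lemma secondDiff_potential_mollify_nonneg (hη : IsMollifier η) (hc : Continuous f)
    (hconv : ∀ x v, 0 ≤ secondDiff (potential f) x v) (hh : 0 < h) (hθ : 0 < θ) (hθ1 : θ < 1)
    (x v : EuclideanSpace ℝ (Fin n)) :
    0 ≤ secondDiff (potential fun y => θ * mollify η f h y) x v := by
  rw [hη.secondDiff_potential_mollify hc hh]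
  have h1 : 0 ≤ ∫ z, secondDiff (potential f) (x - h • z) v ∂(kernelMeasure η) :=
    integral_nonneg fun z => hconv _ _
  have h2 : 0 ≤ 1 - θ := by linarith
  positivity

lemma posDef_hessian_potential_mollify (hη : IsMollifier η) (hc : Continuous f)
    (hconv : ∀ x v, 0 ≤ secondDiff (potential f) x v)
    (hD : ∀ᵐ y, ∃ A, HasHessianAt (potential f) A y) (hh : 0 < h) (hθ : 0 < θ) (hθ1 : θ < 1)
    (x : EuclideanSpace ℝ (Fin n)) :
    (hessian (potential fun y => θ * mollify η f h y) x).PosDef := by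
  have hC := hasHessianAt_hessian (exists_hasHessianAt_potential_mollify hη hc hh θ x)
  refine posDef_of_quadForm_pos hC.1 fun v hv => ?_
  refine lt_of_lt_of_le ?_ (hη.le_quadForm_of_hasHessianAt hc hconv hD hh hθ hC v).2
  have h1 : 0 ≤ ∫ z, quadForm (hessian (potential f) (x - h • z)) v ∂(kernelMeasure η) :=
    integral_nonneg fun z => quadForm_hessian_nonneg hconv _ _
  have h2 : 0 < 1 - θ := by linarith
  have h3 : 0 < ‖v‖ := norm_pos_iff.mpr hv
  positivity

/-- Jensen's inequality for the concave function `log det`, in the form of the averaged tangent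
plane inequality at the Hessian of the approximation. -/
lemma average_log_det_le (hη : IsMollifier η) (hc : Continuous f)
    (hconv : ∀ x v, 0 ≤ secondDiff (potential f) x v)
    (hD : ∀ᵐ y, (∃ A, HasHessianAt (potential f) A y) ∧ 0 < (hessian (potential f) y).det)
    (hh : 0 < h) (hθ : 0 < θ) (hθ1 : θ < 1) (x : EuclideanSpace ℝ (Fin n))
    (hx : Integrable (fun z => Real.log (hessian (potential f) (x - h • z)).det)
      (kernelMeasure η)) :
    θ * ∫ z, Real.log (hessian (potential f) (x - h • z)).det ∂(kernelMeasure η) ≤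
      Real.log (hessian (potential fun y => θ * mollify η f h y) x).det := by
  have := hη.isProbabilityMeasure
  have hD1 : ∀ᵐ y, ∃ A, HasHessianAt (potential f) A y := hD.mono fun y hy => hy.1
  have hC := hasHessianAt_hessian (exists_hasHessianAt_potential_mollify hη hc hh θ x)
  set C := hessian (potential fun y => θ * mollify η f h y) x
  obtain ⟨b, hb, htan⟩ :=
    exists_log_det_le (posDef_hessian_potential_mollify hη hc hconv hD1 hh hθ hθ1 x)
  have hq := fun i => hη.le_quadForm_of_hasHessianAt hc hconv hD1 hh hθ hC (b i)
  have hD' : ∀ᵐ z ∂(kernelMeasure η), 0 < (hessian (potential f) (x - h • z)).det := by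
    refine (kernelMeasure_absolutelyContinuous η).ae_le ?_
    exact (quasiMeasurePreserving_sub_smul hh.ne' x).ae (hD.mono fun y hy => hy.2)
  have hsum : Integrable (fun z => ∑ i, quadForm (hessian (potential f) (x - h • z)) (b i))
      (kernelMeasure η) := integrable_finsetSum _ fun i _ => (hq i).1
  have h1 : ∫ z, Real.log (hessian (potential f) (x - h • z)).det ∂(kernelMeasure η)
      ≤ ∫ z, (∑ i, quadForm (hessian (potential f) (x - h • z)) (b i)
        + (Real.log C.det - n)) ∂(kernelMeasure η) := by
    refine integral_mono_ae hx (hsum.add (integrable_const _)) ?_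
    filter_upwards [hD'] with z hz
    have := htan _ (posSemidef_hessian hconv (x - h • z)) hz
    linarith
  rw [integral_add hsum (integrable_const _), integral_finsetSum _ fun i _ => (hq i).1,
    integral_const, probReal_univ, one_smul] at h1
  -- The tangent plane inequality at the identity matrix handles the summand `(1 - θ) I`.
  have h2 : 0 ≤ Real.log C.det + ∑ i, ‖b i‖ ^ 2 - n := by
    have := htan 1 Matrix.PosSemidef.one (by simp)
    have e : ∀ i, quadForm 1 (b i) = ‖b i‖ ^ 2 := fun i => by
      rw [EuclideanSpace.real_norm_sq_eq]
      simp [quadForm, dotProduct, sq]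
    simpa [e] using this
  have h3 := Finset.sum_le_sum fun i (_ : i ∈ Finset.univ) => (hq i).2
  rw [hb, Finset.sum_add_distrib, ← Finset.mul_sum, ← Finset.mul_sum] at h3
  have h4 := mul_le_mul_of_nonneg_left h1 hθ.le
  have h5 := mul_nonneg (sub_nonneg.mpr hθ1.le) h2
  linarith

/-- The averaged form of Jensen's inequality, integrated over `P`. Integrability comes from the same
lower bound together with the trace as an upper bound. -/
lemma integral_log_det_mollify_ge (hη : IsMollifier η) (hf : IsPeriodic f) (hc : Continuous f)
    (hconv : ∀ x v, 0 ≤ secondDiff (potential f) x v)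
    (hfin : ⊥ < logDetIntegral (potential f)) (hh : 0 < h) (hθ : 0 < θ) (hθ1 : θ < 1) :
    IntegrableOn (fun x => Real.log (hessian (potential fun y => θ * mollify η f h y) x).det)
        (P n) ∧
      θ * ∫ x in P n, Real.log (hessian (potential f) x).det ≤
        ∫ x in P n, Real.log (hessian (potential fun y => θ * mollify η f h y) x).det := by
  have := hη.isProbabilityMeasure
  have hu := continuous_potential hc
  have hD : ∀ᵐ y, (∃ A, HasHessianAt (potential f) A y) ∧ 0 < (hessian (potential f) y).det :=
    ae_of_ae_P (fun i x => by
      simp only [hasHessianAt_potential_add_iff hf, hessian_potential_add hf])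
      (ae_hasHessianAt_and_det_pos hu hfin)
  have hD1 : ∀ᵐ y, ∃ A, HasHessianAt (potential f) A y := hD.mono fun y hy => hy.1
  obtain ⟨hA1, hA2, hA3⟩ := integral_average_translates
    (F := fun x => Real.log (hessian (potential f) x).det)
    (fun i x => by simp only [hessian_potential_add hf]) (measurable_det_hessian hu).log
    (integrableOn_log_det hf hc hconv hfin) (kernelMeasure η) h
  have hmc : Continuous (mollify η f h) := (hη.contDiff_mollify hc hh).continuous
  have hfc : Continuous fun y => θ * mollify η f h y := by fun_prop
  have hfp : IsPeriodic fun y => θ * mollify η f h y := fun i x => by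
    simp only [mollify_periodic hf h i x]
  have hconv' := secondDiff_potential_mollify_nonneg hη hc hconv hh hθ hθ1
  have htr := (integral_trace_hessian_le hfp hfc hconv'
    (Eventually.of_forall (exists_hasHessianAt_potential_mollify hη hc hh θ))).1
  have hlow : ∀ᵐ x ∂(volume.restrict (P n)),
      θ * ∫ z, Real.log (hessian (potential f) (x - h • z)).det ∂(kernelMeasure η) ≤
      Real.log (hessian (potential fun y => θ * mollify η f h y) x).det := by
    filter_upwards [hA1] with x hx
    exact average_log_det_le hη hc hconv hD hh hθ hθ1 x hx
  have hup : ∀ᵐ x ∂(volume.restrict (P n)),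
      Real.log (hessian (potential fun y => θ * mollify η f h y) x).det ≤
        (hessian (potential fun y => θ * mollify η f h y) x).trace := by
    refine Eventually.of_forall fun x => ?_
    have hpd := posDef_hessian_potential_mollify hη hc hconv hD1 hh hθ hθ1 x
    have h1 := log_det_le_trace hpd.posSemidef hpd.det_pos one_pos
    rw [Real.log_one, mul_zero, neg_zero, zero_add, one_mul] at h1
    have h2 : (0 : ℝ) ≤ n := Nat.cast_nonneg n
    linarith
  have hint := integrable_of_le_of_le
    (measurable_det_hessian (continuous_potential hfc)).log.aestronglyMeasurable hlow hup
    (hA2.const_mul θ) htr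
  refine ⟨hint, ?_⟩
  rw [← hA3, ← integral_const_mul]
  exact integral_mono_ae (hA2.const_mul θ) hint hlow

/-- Pointwise convergence of the Hessians of the approximations. -/
lemma tendsto_hessian_potential_mollify (hη : IsMollifier η) (hc : Continuous f)
    {hs θs : ℕ → ℝ} (hs0 : ∀ k, 0 < hs k) (hs1 : Tendsto hs atTop (𝓝 0))
    (hθ1 : Tendsto θs atTop (𝓝 1)) {x : EuclideanSpace ℝ (Fin n)}
    (hx : ∃ A, HasHessianAt (potential f) A x) :
    Tendsto (fun k => hessian (potential fun y => θs k * mollify η f (hs k) y) x) atTop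
      (𝓝 (hessian (potential f) x)) := by
  have hA := hasHessianAt_hessian hx
  have hu := continuous_potential hc
  have hC := fun k => hasHessianAt_hessian
    (exists_hasHessianAt_potential_mollify hη hc (hs0 k) (θs k) x)
  have hq : ∀ v, Tendsto
      (fun k => quadForm (hessian (potential fun y => θs k * mollify η f (hs k) y) x) v) atTop
      (𝓝 (quadForm (hessian (potential f) x) v)) := by
    intro v
    have hlim := (hη.tendsto_quadForm_hessian_mollify hu hA v).comp
      (tendsto_nhdsWithin_iff.mpr ⟨hs1, Eventually.of_forall hs0⟩)
    have h2 := (hθ1.mul hlim).add ((hθ1.const_sub 1).mul_const (‖v‖ ^ 2))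
    rw [one_mul, sub_self, zero_mul, add_zero] at h2
    refine h2.congr fun k => ?_
    obtain ⟨B, hB, -⟩ := exists_hasHessianAt_of_contDiff
      ((hη.contDiff_mollify hu (hs0 k)).of_le two_le_infty) x
    have hB := hasHessianAt_hessian ⟨B, hB⟩
    have h3 := ((hB.tendsto_secondDiff v).const_mul (θs k)).add_const ((1 - θs k) * ‖v‖ ^ 2)
    refine tendsto_nhds_unique h3 (((hC k).tendsto_secondDiff v).congr' ?_)
    filter_upwards [self_mem_nhdsWithin] with t ht
    have ht : t ≠ 0 := ht
    rw [hη.secondDiff_potential_mollify hc (hs0 k), hη.secondDiff_mollify hu (hs0 k), norm_smul,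
      mul_pow, Real.norm_eq_abs, sq_abs]
    field_simp
  refine tendsto_pi_nhds.mpr fun i => tendsto_pi_nhds.mpr fun j => ?_
  rw [apply_eq_polarization hA.1 i j]
  simp only [fun k => apply_eq_polarization (hC k).1 i j]
  exact (((hq _).sub (hq _)).sub (hq _)).div_const 2

lemma integral_const_add_mul_sub {T L : EuclideanSpace ℝ (Fin n) → ℝ}
    (hT : IntegrableOn T (P n)) (hL : IntegrableOn L (P n)) (c ε : ℝ) :
    IntegrableOn (fun x => c + ε * T x - L x) (P n) ∧
      ∫ x in P n, (c + ε * T x - L x) =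
        c * volume.real (P n) + ε * (∫ x in P n, T x) - ∫ x in P n, L x := by
  have hc : IntegrableOn (fun _ : EuclideanSpace ℝ (Fin n) => c) (P n) :=
    integrableOn_const (volume_P_ne_top n)
  have h1 : IntegrableOn (fun x => c + ε * T x) (P n) := hc.add (hT.const_mul ε)
  refine ⟨h1.sub hL, ?_⟩
  rw [integral_sub h1 hL, integral_add hc (hT.const_mul ε), integral_const_mul, integral_const]
  simp [mul_comm]

/-- Convergence of the means of `log det`. The lower bound is Jensen's inequality; for the upper
bound Fatou's lemma is applied to `c + ε tr D²u_k - log det D²u_k`, which is nonnegative by the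
tangent plane inequality, and the means of the traces are bounded by periodicity. -/
lemma tendsto_integral_log_det (hη : IsMollifier η) (hf : IsPeriodic f) (hc : Continuous f)
    (hconv : ∀ x v, 0 ≤ secondDiff (potential f) x v)
    (hfin : ⊥ < logDetIntegral (potential f))
    {hs θs : ℕ → ℝ} (hs0 : ∀ k, 0 < hs k) (hs1 : Tendsto hs atTop (𝓝 0))
    (hθ0 : ∀ k, 0 < θs k) (hθ : ∀ k, θs k < 1) (hθ1 : Tendsto θs atTop (𝓝 1)) :
    Tendsto (fun k => ∫ x in P n,
        Real.log (hessian (potential fun y => θs k * mollify η f (hs k) y) x).det) atTop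
      (𝓝 (∫ x in P n, Real.log (hessian (potential f) x).det)) := by
  have hu := continuous_potential hc
  have hae := ae_hasHessianAt_and_det_pos hu hfin
  have hD1 : ∀ᵐ y, ∃ A, HasHessianAt (potential f) A y :=
    ae_of_ae_P (fun i x => by simp only [hasHessianAt_potential_add_iff hf])
      (hae.mono fun x hx => hx.1)
  have hL := fun k =>
    integral_log_det_mollify_ge hη hf hc hconv hfin (hs0 k) (hθ0 k) (hθ k)
  have hint := integrableOn_log_det hf hc hconv hfin
  have htr := integral_trace_hessian_le hf hc hconv (hae.mono fun x hx => hx.1)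
  have htrk : ∀ k, IntegrableOn
        (fun x => (hessian (potential fun y => θs k * mollify η f (hs k) y) x).trace) (P n) ∧
      ∫ x in P n, (hessian (potential fun y => θs k * mollify η f (hs k) y) x).trace
        ≤ n * volume.real (P n) := fun k => by
    have hmc : Continuous (mollify η f (hs k)) := (hη.contDiff_mollify hc (hs0 k)).continuous
    exact integral_trace_hessian_le
      (fun i x => by simp only [mollify_periodic hf (hs k) i x]) (by fun_prop)
      (secondDiff_potential_mollify_nonneg hη hc hconv (hs0 k) (hθ0 k) (hθ k))
      (Eventually.of_forall (exists_hasHessianAt_potential_mollify hη hc (hs0 k) (θs k)))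
  set I := ∫ x in P n, Real.log (hessian (potential f) x).det with hI
  refine tendsto_order.mpr ⟨fun a ha => ?_, fun a ha => ?_⟩
  · have h1 : Tendsto (fun k => θs k * I) atTop (𝓝 I) := by
      simpa using hθ1.mul_const I
    filter_upwards [h1.eventually_const_lt ha] with k hk
    exact hk.trans_le (hL k).2
  · by_contra hcon
    have hV : 0 ≤ n * volume.real (P n) := by positivity
    set V := n * volume.real (P n)
    set ε := (a - I) / (2 * (V + 1)) with hε
    have hε0 : 0 < ε := div_pos (by linarith) (by positivity)
    have hεV : ε * V < a - I := by
      rw [hε, div_mul_eq_mul_div, div_lt_iff₀ (by positivity)]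
      nlinarith
    set c := -(n * Real.log ε) - n
    have hfat := integrable_and_integral_le_of_tendsto
      (μ := volume.restrict (P n))
      (F := fun k x => c + ε * (hessian (potential fun y => θs k * mollify η f (hs k) y) x).trace
        - Real.log (hessian (potential fun y => θs k * mollify η f (hs k) y) x).det)
      (G := fun x => c + ε * (hessian (potential f) x).trace
        - Real.log (hessian (potential f) x).det)
      (c := c * volume.real (P n) + ε * V - a)
      (fun k => (integral_const_add_mul_sub (htrk k).1 (hL k).1 c ε).1)
      (fun k => Eventually.of_forall fun x => by
        have hpd := posDef_hessian_potential_mollify hη hc hconv hD1 (hs0 k) (hθ0 k) (hθ k) x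
        have := log_det_le_trace hpd.posSemidef hpd.det_pos hε0
        simp only [Pi.zero_apply]
        linarith)
      (by
        filter_upwards [hae] with x hx
        have hlim := tendsto_hessian_potential_mollify hη hc hs0 hs1 hθ1 hx.1
        have hdet := ((continuous_id.matrix_det.tendsto _).comp hlim).log hx.2.ne'
        have htrc := (continuous_id.matrix_trace.tendsto _).comp hlim
        exact ((htrc.const_mul ε).const_add c).sub hdet)
      (by
        refine (not_eventually.mp hcon).mono fun k hk => ?_
        rw [(integral_const_add_mul_sub (htrk k).1 (hL k).1 c ε).2]
        have := mul_le_mul_of_nonneg_left (htrk k).2 hε0.le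
        linarith)
    have h1 := hfat.2
    rw [(integral_const_add_mul_sub htr.1 hint c ε).2] at h1
    have h2 : 0 ≤ ∫ x in P n, (hessian (potential f) x).trace :=
      integral_nonneg fun x => (posSemidef_hessian hconv x).trace_nonneg
    have h3 := mul_nonneg hε0.le h2
    linarith

end Approximation

/-! ### Convergence of the approximations -/

section Convergence

variable {η f : EuclideanSpace ℝ (Fin n) → ℝ}

lemma continuous_of_convexOn_potential (h : ConvexOn ℝ Set.univ (potential f)) :
    Continuous f := by
  have h1 : Continuous (potential f) := h.locallyLipschitz.continuous
  have h2 : f = fun x => potential f x - 1 / 2 * ∑ i, x i ^ 2 := by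
    ext x
    simp [potential]
  rw [h2]
  fun_prop

lemma secondDiff_nonneg_of_convexOn {u : EuclideanSpace ℝ (Fin n) → ℝ}
    (h : ConvexOn ℝ Set.univ u) (x v : EuclideanSpace ℝ (Fin n)) : 0 ≤ secondDiff u x v := by
  have h1 := h.2 (Set.mem_univ (x + v)) (Set.mem_univ (x - v))
    (by norm_num : (0 : ℝ) ≤ 1 / 2) (by norm_num : (0 : ℝ) ≤ 1 / 2) (by norm_num)
  have e : (1 / 2 : ℝ) • (x + v) + (1 / 2 : ℝ) • (x - v) = x := by module
  rw [e, smul_eq_mul, smul_eq_mul] at h1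
  rw [secondDiff]
  linarith

/-- Mollifications of a continuous function converge uniformly on compact sets. -/
lemma IsMollifier.eventually_abs_mollify_sub_le (hη : IsMollifier η) (hc : Continuous f)
    {K : Set (EuclideanSpace ℝ (Fin n))} (hK : IsCompact K) {ε : ℝ} (hε : 0 < ε) :
    ∀ᶠ h in 𝓝[>] (0 : ℝ), ∀ x ∈ K, |mollify η f h x - f x| ≤ ε := by
  have := hη.isProbabilityMeasure
  have huc := (hK.cthickening (r := 1)).uniformContinuousOn_of_continuous hc.continuousOn
  rw [Metric.uniformContinuousOn_iff_le] at huc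
  obtain ⟨δ, hδ, hu⟩ := huc ε hε
  filter_upwards [self_mem_nhdsWithin, nhdsWithin_le_nhds (Iio_mem_nhds hδ),
    nhdsWithin_le_nhds (Iio_mem_nhds one_pos)] with h hh hhδ hh1 x hx
  have hh : 0 < h := hh
  have hint : Integrable (fun z => f (x - h • z)) (kernelMeasure η) :=
    hη.integrable_of_continuous (by fun_prop)
  have e : mollify η f h x - f x = ∫ z, (f (x - h • z) - f x) ∂(kernelMeasure η) := by
    rw [integral_sub hint (integrable_const _), hη.mollify_eq f hh]
    simp
  rw [e, ← Real.norm_eq_abs]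
  refine (norm_integral_le_of_norm_le_const (C := ε) ?_).trans (by simp)
  filter_upwards [hη.ae_norm_le] with z hz
  have hd : dist (x - h • z) x ≤ h := by
    rw [dist_eq_norm, sub_sub_cancel_left, norm_neg, norm_smul, Real.norm_of_nonneg hh.le]
    exact mul_le_of_le_one_right hh.le hz
  rw [← dist_eq_norm]
  exact hu _ (Metric.mem_cthickening_of_dist_le _ x _ _ hx (hd.trans (le_of_lt hh1))) _
    (Metric.self_subset_cthickening _ hx) (hd.trans (le_of_lt hhδ))

lemma tendsto_natCast_div_add_one :
    Tendsto (fun m : ℕ => (m : ℝ) / ((m : ℝ) + 1)) atTop (𝓝 1) :=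
  tendsto_natCast_div_add_atTop 1

/-- The approximations converge to the potential in `L²(P)`, for every rate. -/
lemma tendsto_eLpNorm_approximant_sub (hη : IsMollifier η) (hc : Continuous f) {r : ℕ → ℕ}
    (hr : ∀ i, i ≤ r i) :
    Tendsto (fun m => eLpNorm (fun x => approximant η f r m x - potential f x) 2
      (volume.restrict (P n))) atTop (𝓝 0) := by
  obtain ⟨M, hM⟩ := (isCompact_P n).exists_bound_of_continuousOn hc.continuousOn
  have hh : Tendsto (fun m => 1 / (r m : ℝ)) atTop (𝓝[>] 0) := by
    refine tendsto_nhdsWithin_iff.mpr ⟨?_, ?_⟩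
    · exact tendsto_one_div_atTop_nhds_zero_nat.comp (tendsto_atTop_mono hr tendsto_id)
    · filter_upwards [eventually_ge_atTop 1] with m hm
      have : 0 < (r m : ℝ) := by exact_mod_cast lt_of_lt_of_le hm (hr m)
      exact one_div_pos.mpr this
  have hunif : ∀ δ > 0, ∀ᶠ m in atTop, ∀ x ∈ P n,
      ‖approximant η f r m x - potential f x‖ ≤ δ := by
    intro δ hδ
    have h1 : Tendsto (fun m : ℕ => |(m : ℝ) / ((m : ℝ) + 1) - 1| * M) atTop (𝓝 0) := by
      simpa using ((tendsto_natCast_div_add_one.sub_const 1).abs.mul_const M)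
    filter_upwards [hh.eventually (hη.eventually_abs_mollify_sub_le hc (isCompact_P n)
      (half_pos hδ)), h1.eventually_le_const (half_pos hδ)] with m hm1 hm2 x hx
    have hθ0 : 0 ≤ (m : ℝ) / ((m : ℝ) + 1) := by positivity
    have hθ1 : (m : ℝ) / ((m : ℝ) + 1) ≤ 1 := by
      rw [div_le_one (by positivity)]
      linarith
    have e : approximant η f r m x - potential f x
        = (m : ℝ) / ((m : ℝ) + 1) * (mollify η f (1 / (r m : ℝ)) x - f x)
          + ((m : ℝ) / ((m : ℝ) + 1) - 1) * f x := by
      simp only [approximant, potential]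
      ring
    rw [e]
    refine (norm_add_le _ _).trans ?_
    rw [norm_mul, norm_mul, Real.norm_of_nonneg hθ0]
    have h2 : (m : ℝ) / ((m : ℝ) + 1) * ‖mollify η f (1 / (r m : ℝ)) x - f x‖ ≤ δ / 2 :=
      (mul_le_of_le_one_left (norm_nonneg _) hθ1).trans (hm1 x hx)
    have h3 : ‖(m : ℝ) / ((m : ℝ) + 1) - 1‖ * ‖f x‖ ≤ δ / 2 :=
      (mul_le_mul_of_nonneg_left (hM x hx) (norm_nonneg _)).trans hm2
    linarith
  rw [ENNReal.tendsto_nhds_zero]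
  intro ε hε
  set V := (volume.restrict (P n)) Set.univ ^ (2 : ℝ≥0∞).toReal⁻¹
  have hV : V ≠ ⊤ := by
    refine ENNReal.rpow_ne_top_of_nonneg (by simp) ?_
    rw [Measure.restrict_apply_univ]
    exact volume_P_ne_top n
  have hlim : Tendsto (fun δ : ℝ => V * ENNReal.ofReal δ) (𝓝[>] 0) (𝓝 0) := by
    have h1 : Tendsto (fun δ : ℝ => ENNReal.ofReal δ) (𝓝[>] 0) (𝓝 0) := by
      simpa using (ENNReal.continuous_ofReal.tendsto 0).mono_left nhdsWithin_le_nhds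
    simpa using ENNReal.Tendsto.const_mul h1 (Or.inr hV)
  obtain ⟨δ, hδε, hδ⟩ := ((hlim.eventually_le_const hε).and self_mem_nhdsWithin).exists
  filter_upwards [hunif δ hδ] with m hm
  refine (eLpNorm_le_of_ae_bound ?_).trans hδε
  filter_upwards [ae_restrict_mem (measurableSet_P n)] with x hx
  exact hm x hx

/-- The approximations with `r(m) = m` already have convergent `log det` integrals. -/
lemma tendsto_logDetIntegral_approximant (hη : IsMollifier η) (hf : IsPeriodic f)
    (hconv : ConvexOn ℝ Set.univ (potential f))
    (hfin : ⊥ < logDetIntegral (potential f)) :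
    Tendsto (fun m => logDetIntegral (approximant η f id m)) atTop
      (𝓝 (logDetIntegral (potential f))) := by
  have hc := continuous_of_convexOn_potential hconv
  have hsd := secondDiff_nonneg_of_convexOn hconv
  have hae := ae_hasHessianAt_and_det_pos (continuous_potential hc) hfin
  have hD1 : ∀ᵐ y, ∃ A, HasHessianAt (potential f) A y :=
    ae_of_ae_P (fun i x => by simp only [hasHessianAt_potential_add_iff hf])
      (hae.mono fun x hx => hx.1)
  -- At `m = 0` the scale `1 / m` is a junk value, so the sequence is shifted by one.
  rw [← tendsto_add_atTop_iff_nat 1]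
  let hs : ℕ → ℝ := fun k => 1 / ((k + 1 : ℕ) : ℝ)
  let θs : ℕ → ℝ := fun k => ((k + 1 : ℕ) : ℝ) / (((k + 1 : ℕ) : ℝ) + 1)
  have hs0 : ∀ k, 0 < hs k := fun k => by positivity
  have hθ0 : ∀ k, 0 < θs k := fun k => by positivity
  have hθ : ∀ k, θs k < 1 := fun k => by
    simp only [θs]
    rw [div_lt_one (by positivity)]
    linarith
  have hs1 : Tendsto hs atTop (𝓝 0) :=
    (tendsto_add_atTop_iff_nat 1).mpr tendsto_one_div_atTop_nhds_zero_nat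
  have hθ1 : Tendsto θs atTop (𝓝 1) :=
    (tendsto_add_atTop_iff_nat 1).mpr tendsto_natCast_div_add_one
  have hlim := tendsto_integral_log_det hη hf hc hsd hfin hs0 hs1 hθ0 hθ hθ1
  rw [logDetIntegral_eq (hae.mono fun x hx => hx.2) (integrableOn_log_det hf hc hsd hfin)]
  refine ((continuous_coe_real_ereal.tendsto _).comp hlim).congr fun k => ?_
  have hk : approximant η f id (k + 1) = potential fun y => θs k * mollify η f (hs k) y := rfl
  rw [hk, logDetIntegral_eq _
    (integral_log_det_mollify_ge hη hf hc hsd hfin (hs0 k) (hθ0 k) (hθ k)).1]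
  · rfl
  · exact Eventually.of_forall fun x => (posDef_hessian_potential_mollify hη hc hsd hD1
      (hs0 k) (hθ0 k) (hθ k) x).det_pos

end Convergence

end TorusPotential

end

theorem lemma5p1 (n : ℕ) (η : EuclideanSpace ℝ (Fin n) → ℝ)
    (hη : TorusPotential.IsMollifier η)
    (f : EuclideanSpace ℝ (Fin n) → ℝ) (hf : f ∈ TorusPotential.completedPotentials n) :
    (∀ r : ℕ → ℕ, (∀ i, i ≤ r i) →
      Tendsto
        (fun m => eLpNorm
          (fun x => TorusPotential.approximant η f r m x - TorusPotential.potential f x) 2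
          (volume.restrict (TorusPotential.P n)))
        atTop (𝓝 0)) ∧
    (⊥ < TorusPotential.logDetIntegral (TorusPotential.potential f) →
      ∃ r : ℕ → ℕ, (∀ i, i ≤ r i) ∧
        Tendsto
          (fun m => TorusPotential.logDetIntegral (TorusPotential.approximant η f r m))
          atTop (𝓝 (TorusPotential.logDetIntegral (TorusPotential.potential f)))) := by
  obtain ⟨hper, hconv, -⟩ := hf
  exact ⟨fun r hr => TorusPotential.tendsto_eLpNorm_approximant_sub hη
      (TorusPotential.continuous_of_convexOn_potential hconv) hr,
    fun hfin => ⟨id, fun i => le_rfl,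
      TorusPotential.tendsto_logDetIntegral_approximant hη hper hconv hfin⟩⟩
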